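/- Let $N\ge 1$ be an integer, $\alpha>0$, $0<p-1<q<\infty$, $\alpha p<N$ and $0<s\le\infty$. For a nonnegative Radon measure $\mu$ on $\mathbb R^N$, $0<R\le\infty$ and $x\in\mathbb R^N$ set $$W^R_{\alpha,p}[\mu](x)=\int_0^R\Big(\frac{\mu(B_t(x))}{t^{N-\alpha p}}\Big)^{\frac1{p-1}}\frac{dt}{t},\qquad M_{\alpha p,R}[\mu](x)=\sup_{0<t<R}\frac{\mu(B_t(x))}{t^{N-\alpha p}},\qquad G_{\alpha p}[\mu](x)=\int_{\mathbb R^N}G_{\alpha p}(x-y)\,d\mu(y),$$ where $B_t(x)$ is the open ball with centre $x$ and radius $t$ and $G_\beta$ is the Bessel kernel of order $\beta$, $G_\beta(x)=\frac1{\Gamma(\beta/2)}\int_0^\infty t^{\frac\beta2-1}e^{-t}(4\pi t)^{-\frac N2}e^{-|x|^2/(4t)}\,dt$. For measurable $f:\mathbb R^N\to[0,\infty]$ and $t>0$ let $f^*(t)=\inf\{\lambda>0:|\{f>\lambda\}|\le t\}$ and $f^{**}(t)=\frac1t\int_0^tf^*(\tau)\,d\tau$; for $0<a<\infty$, $0<b\le\infty$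 let $\|f\|_{L^{a,b}}\in[0,\infty]$ be the $L^b((0,\infty),\frac{dt}t)$ (quasi-)norm of $t\mapsto t^{1/a}f^{**}(t)$ if $a>1$, and of $t\mapsto t^{1/a}f^*(t)$ if $a\le1$. Then there is a constant $c_1>0$ depending only on $N,\alpha,p,q,s$ such that for all $R\in(0,\infty]$ and all nonnegative Radon measures $\mu$ on $\mathbb R^N$ $$c_1^{-1}\|W^R_{\alpha,p}[\mu]\|_{L^{q,s}}\le\|M_{\alpha p,R}[\mu]\|^{\frac1{p-1}}_{L^{\frac q{p-1},\frac s{p-1}}}\le c_1\|W^R_{\alpha,p}[\mu]\|_{L^{q,s}}.$$ Moreover, for every $R\in(0,\infty)$ there is a constant $c_2>0$ depending only on $N,\alpha,p,q,s,R$ such that for all nonnegative Radon measures $\mu$ on $\mathbb R^N$ $$c_2^{-1}\|W^R_{\alpha,p}[\mu]\|_{L^{q,s}}\le\|G_{\alpha p}[\mu]\|^{\frac1{p-1}}_{L^{\frac q{p-1},\frac s{p-1}}}\le c_2\|W^R_{\alpha,p}[\mu]\|_{L^{q,s}},$$ and the same two inequalities hold with $\|W^R_{\alpha,p}[\mu]\|_{L^{q,s}}$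 replaced by $\|M_{\alpha p,R}[\mu]\|^{\frac1{p-1}}_{L^{\frac q{p-1},\frac s{p-1}}}$. (All quantities may be $+\infty$.) -/

import Mathlib

open MeasureTheory Set
open scoped ENNReal NNReal

noncomputable section

/-- The distribution function `s ↦ ν {x | s < f x}` of a `[0, ∞]`-valued function. -/
def distribFun {X : Type*} [MeasurableSpace X] (ν : Measure X) (f : X → ℝ≥0∞) (s : ℝ≥0∞) :
    ℝ≥0∞ :=
  ν {x | s < f x}

/-- The decreasing rearrangement `f^*(t) = inf {s ≥ 0 : ν {f > s} ≤ t}`, for `t > 0`. -/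
def decrRearr {X : Type*} [MeasurableSpace X] (ν : Measure X) (f : X → ℝ≥0∞) (t : ℝ) : ℝ≥0∞ :=
  sInf {s : ℝ≥0∞ | distribFun ν f s ≤ ENNReal.ofReal t}

/-- The maximal rearrangement `f^{**}(t) = (1 / t) ∫_0^t f^*(τ) dτ`, for `t > 0`. -/
def maxRearr {X : Type*} [MeasurableSpace X] (ν : Measure X) (f : X → ℝ≥0∞) (t : ℝ) : ℝ≥0∞ :=
  (∫⁻ τ in Ioo (0 : ℝ) t, decrRearr ν f τ) / ENNReal.ofReal t

/-- The measure `dt / t` on `(0, ∞)`. -/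
def haarPos : Measure ℝ :=
  (volume.restrict (Ioi (0 : ℝ))).withDensity fun t => (ENNReal.ofReal t)⁻¹

/-- The Lorentz (quasi-)norm of `L^{q,s}`, `0 < q < ∞`, `0 < s ≤ ∞`: the `L^s((0, ∞), dt / t)`
(quasi-)norm of `t^{1/q} f^{**}(t)` if `q > 1`, and that of `t^{1/q} f^*(t)` if `q ≤ 1`
(where the expression with `f^{**}` does not define the Lorentz space). For `s = ∞` the
`L^s` norm is the essential supremum over `t > 0`. The value is in `[0, ∞]`. -/
def lorentzNorm {X : Type*} [MeasurableSpace X] (ν : Measure X) (q : ℝ) (s : ℝ≥0∞)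
    (f : X → ℝ≥0∞) : ℝ≥0∞ :=
  if 1 < q then
    eLpNorm (fun t : ℝ => ENNReal.ofReal (t ^ (1 / q)) * maxRearr ν f t) s haarPos
  else
    eLpNorm (fun t : ℝ => ENNReal.ofReal (t ^ (1 / q)) * decrRearr ν f t) s haarPos

/-- The `R`-truncated Wolff potential
`∫_0^R (μ(B_t(x)) / t^{N - α p})^{1 / (p - 1)} dt / t`, for `0 < R ≤ ∞`. -/
def wolffPotential {N : ℕ} (α p : ℝ) (R : ℝ≥0∞) (μ : Measure (EuclideanSpace ℝ (Fin N)))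
    (x : EuclideanSpace ℝ (Fin N)) : ℝ≥0∞ :=
  ∫⁻ t in {t : ℝ | 0 < t ∧ ENNReal.ofReal t < R},
    (μ (Metric.ball x t) / ENNReal.ofReal (t ^ ((N : ℝ) - α * p))) ^ (1 / (p - 1))
      / ENNReal.ofReal t

/-- The `R`-truncated fractional maximal function of order `β`,
`sup_{0 < t < R} μ(B_t(x)) / t^{N - β}`, for `0 < R ≤ ∞`. -/
def fracMaximal {N : ℕ} (β : ℝ) (R : ℝ≥0∞) (μ : Measure (EuclideanSpace ℝ (Fin N)))
    (x : EuclideanSpace ℝ (Fin N)) : ℝ≥0∞ :=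
  ⨆ (t : ℝ) (_ : 0 < t) (_ : ENNReal.ofReal t < R),
    μ (Metric.ball x t) / ENNReal.ofReal (t ^ ((N : ℝ) - β))

/-- The Bessel kernel of order `β > 0` on `ℝ^N`, the convolution kernel of `(1 - Δ)^{-β/2}`,
as a superposition of heat kernels:
`G_β(x) = Γ(β/2)⁻¹ ∫_0^∞ t^{β/2 - 1} e^{-t} (4 π t)^{-N/2} e^{-|x|² / (4 t)} dt`. -/
def besselKernel {N : ℕ} (β : ℝ) (x : EuclideanSpace ℝ (Fin N)) : ℝ≥0∞ :=
  (∫⁻ t in Ioi (0 : ℝ), ENNReal.ofReal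
      (t ^ (β / 2 - 1) * Real.exp (-t) * (4 * Real.pi * t) ^ (-(N : ℝ) / 2)
        * Real.exp (-‖x‖ ^ 2 / (4 * t))))
    / ENNReal.ofReal (Real.Gamma (β / 2))

/-- The Bessel potential `∫ G_β(x - y) dμ(y)` of a measure. -/
def besselPotentialMeas {N : ℕ} (β : ℝ) (μ : Measure (EuclideanSpace ℝ (Fin N)))
    (x : EuclideanSpace ℝ (Fin N)) : ℝ≥0∞ :=
  ∫⁻ y, besselKernel β (x - y) ∂μ

end

/-!
The three quantities are compared on the level of decreasing rearrangements with respect to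
Lebesgue measure, which turns every Lorentz norm inequality into a statement about the weighted
norm `wNorm` of functions on `(0, ∞)`. Write `β = α p`, `d = N - β`, `θ = 1 / (p - 1)`.

The heart of the matter is the inequality
`W^*(t) ≤ W^*(2 t) + C (M_{64 R}^*(t / 2))^θ`
for the truncated Wolff potential `W` and the fractional maximal function `M`
(`exists_decrRearr_truncWolff_le_add`), a good-`λ` inequality in rearranged form. Cover
`{W > W^*(2 t)}` by Vitali balls whose radius `r` is comparable to the distance to the complement,
but at most `R`. On such a ball the scales above `r` contribute at most `W^*(2 t)` plus a multiple
of `M^θ`, by comparison with a nearby point of the complement (`exists_far_le_truncWolff_add`),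
while the scales below `r` are controlled outside a small proportion of the ball by Tonelli's
theorem and Markov's inequality (`volume_localPotential_gt_le`). For compactly supported `μ` and
finite `R` the potential has bounded support, so the inequality can be iterated to
`W^*(t) ≤ ∑ C (M^*(c 2^k t))^θ`; monotone limits extend this to all `μ` and `R`
(`exists_decrRearr_truncWolff_le_tsum`). Since dilations act on `wNorm` by powers, such a series is
summed by `wNorm_le_of_le_tsum_dilation`, uniformly in `0 < s ≤ ∞`; the same lemma gives Hardy's
inequality, which replaces `f^{**}` by `f^*`.

Conversely `M_{R / 2}^θ ≤ C W_R` pointwise, and changing the truncation radius of `M` only costs a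
constant, because a large ball is covered by boundedly many translates of a smaller one and
rearrangements are translation invariant (`exists_decrRearr_doubling`).

For the Bessel potential, `M_R ≤ C G` pointwise. In the other direction the kernel splits into a
truncated Riesz kernel, whose potential is the Wolff potential with `θ = 1`, and a rapidly
decreasing tail, which is a series of measures of dyadic balls; each of these is again compared
with `M_R` by doubling (`exists_wNorm_besselPotentialMeas_le`).
-/

/-! ### Decreasing rearrangements -/

section Rearrangement

variable {X : Type*} [MeasurableSpace X] {ν : Measure X}

theorem decrRearr_le_of_distribFun_le {f : X → ℝ≥0∞} {t : ℝ} {l : ℝ≥0∞}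
    (h : distribFun ν f l ≤ ENNReal.ofReal t) : decrRearr ν f t ≤ l :=
  sInf_le h

/-- The infimum defining `f^*(t)` is attained: the distribution function is right-continuous. -/
theorem distribFun_decrRearr_le (f : X → ℝ≥0∞) (t : ℝ) :
    distribFun ν f (decrRearr ν f t) ≤ ENNReal.ofReal t := by
  have hne : {l : ℝ≥0∞ | distribFun ν f l ≤ ENNReal.ofReal t}.Nonempty :=
    ⟨⊤, by simp [distribFun]⟩
  obtain ⟨u, hu, hlim, hmem⟩ := exists_seq_tendsto_sInf hne (OrderBot.bddBelow _)
  have hset : {x | decrRearr ν f t < f x} = ⋃ n, {x | u n < f x} := by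
    ext x
    simp only [mem_ofPred_eq, mem_iUnion]
    constructor
    · intro hx
      exact ((tendsto_order.1 hlim).2 _ hx).exists
    · rintro ⟨n, hn⟩
      exact (sInf_le (hmem n)).trans_lt hn
  have hmono : Monotone fun n => {x | u n < f x} := fun m n hmn x hx =>
    (hu hmn).trans_lt hx
  unfold distribFun
  rw [hset, hmono.measure_iUnion]
  exact iSup_le hmem

theorem decrRearr_antitone (f : X → ℝ≥0∞) : Antitone (decrRearr ν f) := fun _ _ hst =>
  sInf_le_sInf fun _ hl => le_trans hl (ENNReal.ofReal_le_ofReal hst)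

theorem decrRearr_measurable (f : X → ℝ≥0∞) : Measurable (decrRearr ν f) :=
  (decrRearr_antitone f).measurable

theorem decrRearr_mono {f g : X → ℝ≥0∞} (h : ∀ x, f x ≤ g x) (t : ℝ) :
    decrRearr ν f t ≤ decrRearr ν g t :=
  sInf_le_sInf fun _ hl => le_trans (measure_mono fun x hx => lt_of_lt_of_le hx (h x)) hl

/-- Rearrangements pass to the limit along increasing sequences. -/
theorem decrRearr_iSup_le {f : ℕ → X → ℝ≥0∞} (hf : Monotone f) (t : ℝ) :
    decrRearr ν (fun x => ⨆ n, f n x) t ≤ ⨆ n, decrRearr ν (f n) t := by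
  apply decrRearr_le_of_distribFun_le
  set l := ⨆ n, decrRearr ν (f n) t
  have hset : {x | l < ⨆ n, f n x} = ⋃ n, {x | l < f n x} := by
    ext x; simp [lt_iSup_iff]
  have hmono : Monotone fun n => {x | l < f n x} := fun m n hmn x hx =>
    lt_of_lt_of_le hx (hf hmn x)
  unfold distribFun
  rw [hset, hmono.measure_iUnion]
  refine iSup_le fun n => le_trans (measure_mono fun x hx => ?_) (distribFun_decrRearr_le (f n) t)
  exact lt_of_le_of_lt (le_iSup (fun n => decrRearr ν (f n) t) n) hx

/-- Rearrangements of a series: the sum exceeds the sum of the levels only where some term exceeds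
its level. -/
theorem decrRearr_tsum_le (f : ℕ → X → ℝ≥0∞) (τ : ℕ → ℝ) {t : ℝ}
    (hτ : ∑' k, ENNReal.ofReal (τ k) ≤ ENNReal.ofReal t) :
    decrRearr ν (fun x => ∑' k, f k x) t ≤ ∑' k, decrRearr ν (f k) (τ k) := by
  apply decrRearr_le_of_distribFun_le
  have hsub : {x | ∑' k, decrRearr ν (f k) (τ k) < ∑' k, f k x} ⊆
      ⋃ k, {x | decrRearr ν (f k) (τ k) < f k x} := by
    intro x hx
    by_contra hcon
    simp only [mem_iUnion, mem_ofPred_eq, not_exists, not_lt] at hcon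
    exact absurd hx (not_lt.2 (ENNReal.tsum_le_tsum hcon))
  calc distribFun ν (fun x => ∑' k, f k x) (∑' k, decrRearr ν (f k) (τ k))
      ≤ ν (⋃ k, {x | decrRearr ν (f k) (τ k) < f k x}) := measure_mono hsub
    _ ≤ ∑' k, ν {x | decrRearr ν (f k) (τ k) < f k x} := measure_iUnion_le _
    _ ≤ ∑' k, ENNReal.ofReal (τ k) :=
        ENNReal.tsum_le_tsum fun k => distribFun_decrRearr_le (f k) (τ k)
    _ ≤ _ := hτ

theorem decrRearr_add_le (f g : X → ℝ≥0∞) {t : ℝ} (ht : 0 ≤ t) :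
    decrRearr ν (fun x => f x + g x) t ≤ decrRearr ν f (t / 2) + decrRearr ν g (t / 2) := by
  apply decrRearr_le_of_distribFun_le
  have hsub : {x | decrRearr ν f (t / 2) + decrRearr ν g (t / 2) < f x + g x} ⊆
      {x | decrRearr ν f (t / 2) < f x} ∪ {x | decrRearr ν g (t / 2) < g x} := by
    intro x hx
    by_contra hcon
    simp only [mem_union, mem_ofPred_eq, not_or, not_lt] at hcon
    exact absurd hx (not_lt.2 (add_le_add hcon.1 hcon.2))
  refine (measure_mono hsub).trans ((measure_union_le _ _).trans ?_)
  refine (add_le_add (distribFun_decrRearr_le f (t / 2)) (distribFun_decrRearr_le g (t / 2))).trans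
    (le_of_eq ?_)
  rw [← ENNReal.ofReal_add (by linarith) (by linarith), add_halves]

theorem decrRearr_const_mul_le (c : ℝ≥0∞) (f : X → ℝ≥0∞) (t : ℝ) :
    decrRearr ν (fun x => c * f x) t ≤ c * decrRearr ν f t := by
  apply decrRearr_le_of_distribFun_le
  refine (measure_mono fun x hx => ?_).trans (distribFun_decrRearr_le f t)
  have hx' : c * decrRearr ν f t < c * f x := hx
  exact lt_of_mul_lt_mul_left' hx'

theorem decrRearr_rpow (f : X → ℝ≥0∞) {θ : ℝ} (hθ : 0 < θ) (t : ℝ) :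
    decrRearr ν (fun x => f x ^ θ) t = decrRearr ν f t ^ θ := by
  have key : ∀ (g : X → ℝ≥0∞) (η : ℝ), 0 < η →
      decrRearr ν (fun x => g x ^ η) t ≤ decrRearr ν g t ^ η := by
    intro g η hη
    apply decrRearr_le_of_distribFun_le
    refine (measure_mono fun x hx => ?_).trans (distribFun_decrRearr_le g t)
    exact (ENNReal.rpow_lt_rpow_iff hη).1 hx
  refine le_antisymm (key f θ hθ) ?_
  have h := key (fun x => f x ^ θ) θ⁻¹ (inv_pos.2 hθ)
  simp only [ENNReal.rpow_rpow_inv hθ.ne'] at h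
  exact (ENNReal.le_rpow_inv_iff hθ).1 h

theorem decrRearr_finset_sum_le {ι : Type*} (S : Finset ι) (f : ι → X → ℝ≥0∞) {t : ℝ}
    {l : ℝ≥0∞} (hl : ∀ i ∈ S, decrRearr ν (f i) t ≤ l) :
    decrRearr ν (fun x => ∑ i ∈ S, f i x) (S.card * t) ≤ S.card * l := by
  apply decrRearr_le_of_distribFun_le
  have hsub : {x | (S.card : ℝ≥0∞) * l < ∑ i ∈ S, f i x} ⊆
      ⋃ i ∈ S, {x | decrRearr ν (f i) t < f i x} := by
    intro x hx
    by_contra hcon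
    simp only [mem_iUnion, mem_ofPred_eq, not_exists, not_lt] at hcon
    have hx' : (S.card : ℝ≥0∞) * l < ∑ i ∈ S, f i x := hx
    refine absurd hx' (not_lt.2 ?_)
    rw [← nsmul_eq_mul]
    exact Finset.sum_le_card_nsmul _ _ _ fun i hi => (hcon i hi).trans (hl i hi)
  refine (measure_mono hsub).trans ((measure_biUnion_finset_le S _).trans ?_)
  refine (Finset.sum_le_card_nsmul S _ (ENNReal.ofReal t)
    fun i _ => distribFun_decrRearr_le (f i) t).trans (le_of_eq ?_)
  rw [nsmul_eq_mul, ENNReal.ofReal_mul (by positivity), ENNReal.ofReal_natCast]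

theorem decrRearr_comp_add_right {E : Type*} [MeasurableSpace E] [AddGroup E] [MeasurableAdd E]
    (ν : Measure E) [ν.IsAddRightInvariant] (f : E → ℝ≥0∞) (v : E) (t : ℝ) :
    decrRearr ν (fun x => f (x + v)) t = decrRearr ν f t := by
  have : distribFun ν (fun x => f (x + v)) = distribFun ν f := by
    funext l
    exact measure_preimage_add_right ν v {x | l < f x}
  simp only [decrRearr, this]

end Rearrangement

/-! ### Weighted norms and dilations -/

section WeightedNorm

theorem lintegral_haarPos (f : ℝ → ℝ≥0∞) :
    ∫⁻ t, f t ∂haarPos = ∫⁻ t in Ioi (0 : ℝ), (ENNReal.ofReal t)⁻¹ * f t := by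
  unfold haarPos
  rw [lintegral_withDensity_eq_lintegral_mul_non_measurable _
    (by fun_prop) ]
  · rfl
  · filter_upwards [ae_restrict_mem measurableSet_Ioi] with t ht
    simpa using ht

theorem ae_haarPos_pos : ∀ᵐ t ∂haarPos, 0 < t :=
  (withDensity_absolutelyContinuous _ _).ae_le (ae_restrict_mem measurableSet_Ioi)

/-- The measure `dt / t` is invariant under dilations. -/
theorem measurePreserving_mul_haarPos {b : ℝ} (hb : 0 < b) :
    MeasurePreserving (fun t => b * t) haarPos haarPos := by
  refine ⟨by fun_prop, ?_⟩
  refine Measure.ext_of_lintegral _ fun f hf => ?_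
  rw [lintegral_map hf (by fun_prop), lintegral_haarPos, lintegral_haarPos]
  rw [← lintegral_indicator measurableSet_Ioi, ← lintegral_indicator measurableSet_Ioi]
  set F : ℝ → ℝ≥0∞ := (Ioi (0 : ℝ)).indicator fun t => (ENNReal.ofReal t)⁻¹ * f t
  have hF : Measurable F := by
    apply Measurable.indicator _ measurableSet_Ioi
    fun_prop
  have h1 : ∀ t, (Ioi (0 : ℝ)).indicator (fun t => (ENNReal.ofReal t)⁻¹ * f (b * t)) t
      = ENNReal.ofReal b * F (b * t) := by
    intro t
    by_cases ht : 0 < t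
    · have hbt : 0 < b * t := mul_pos hb ht
      simp only [F, indicator, mem_Ioi, ht, hbt, if_true]
      rw [ENNReal.ofReal_mul hb.le, ENNReal.mul_inv (by simp [hb]) (by simp), ← mul_assoc,
        ← mul_assoc, ENNReal.mul_inv_cancel (by simpa using hb) (by simp), one_mul]
    · have hbt : ¬ 0 < b * t := by
        intro h; exact ht (pos_of_mul_pos_right h hb.le)
      simp [F, indicator, ht, hbt]
  rw [lintegral_congr h1, lintegral_const_mul _ (by fun_prop)]
  have h2 := Real.map_volume_mul_left hb.ne'
  have h3 : ∫⁻ t, F (b * t) = ∫⁻ t, F t ∂(Measure.map (b * ·) volume) :=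
    (lintegral_map hF (by fun_prop)).symm
  rw [h3, h2, lintegral_smul_measure, abs_of_pos (inv_pos.2 hb), smul_eq_mul, ← mul_assoc,
    ← ENNReal.ofReal_mul hb.le, mul_inv_cancel₀ hb.ne', ENNReal.ofReal_one, one_mul]

/-- The weighted quasi-norm `‖t^{1/q} g(t)‖` in `L^s((0, ∞), dt / t)`. For `g = f^*` it is the
Lorentz quasi-norm of `f` defined through the decreasing rearrangement. -/
noncomputable def wNorm (q : ℝ) (s : ℝ≥0∞) (g : ℝ → ℝ≥0∞) : ℝ≥0∞ :=
  eLpNorm (fun t : ℝ => ENNReal.ofReal (t ^ (1 / q)) * g t) s haarPos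

theorem wNorm_mono {q : ℝ} {s : ℝ≥0∞} {f g : ℝ → ℝ≥0∞} (h : ∀ t, 0 < t → f t ≤ g t) :
    wNorm q s f ≤ wNorm q s g := by
  apply eLpNorm_mono_enorm_ae
  filter_upwards [ae_haarPos_pos] with t ht
  simp only [enorm_eq_self]
  gcongr
  exact h t ht

theorem wNorm_rpow {q : ℝ} (s : ℝ≥0∞) {θ : ℝ} (hθ : 0 < θ) (g : ℝ → ℝ≥0∞) :
    wNorm q s (fun t => g t ^ θ) = wNorm (q * θ) (s * ENNReal.ofReal θ) g ^ θ := by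
  unfold wNorm
  rw [← eLpNorm_enorm_rpow _ hθ]
  apply eLpNorm_congr_ae
  filter_upwards [ae_haarPos_pos] with t ht
  rw [enorm_eq_self, ENNReal.mul_rpow_of_nonneg _ _ hθ.le,
    ENNReal.ofReal_rpow_of_nonneg (by positivity) hθ.le, ← Real.rpow_mul ht.le]
  congr 4
  by_cases hq : q = 0
  · simp [hq]
  · field_simp

theorem wNorm_const_mul_le {q : ℝ} (s : ℝ≥0∞) (c : ℝ≥0) (g : ℝ → ℝ≥0∞) :
    wNorm q s (fun t => c * g t) ≤ c * wNorm q s g := by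
  refine eLpNorm_le_nnreal_smul_eLpNorm_of_ae_le_mul' (Filter.Eventually.of_forall fun t => ?_) s
  simp only [enorm_eq_self]
  exact (mul_left_comm _ _ _).le

theorem wNorm_comp_mul_le {q : ℝ} (s : ℝ≥0∞) {b : ℝ} (hb : 0 < b) {g : ℝ → ℝ≥0∞}
    (hg : Measurable g) :
    wNorm q s (fun t => g (b * t)) ≤ ENNReal.ofReal (b ^ (-(1 / q))) * wNorm q s g := by
  have hm : Measurable fun t : ℝ => ENNReal.ofReal (t ^ (1 / q)) * g t := by fun_prop
  have h1 := eLpNorm_comp_measurePreserving (p := s) hm.aestronglyMeasurable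
    (measurePreserving_mul_haarPos hb)
  unfold wNorm
  rw [← h1]
  refine eLpNorm_le_nnreal_smul_eLpNorm_of_ae_le_mul' (c := (b ^ (-(1 / q))).toNNReal) ?_ s
  filter_upwards [ae_haarPos_pos] with t ht
  simp only [Function.comp, enorm_eq_self]
  change _ ≤ ENNReal.ofReal (b ^ (-(1 / q))) * _
  rw [← mul_assoc, ← ENNReal.ofReal_mul (by positivity), Real.mul_rpow hb.le ht.le,
    ← mul_assoc, ← Real.rpow_add hb, neg_add_cancel, Real.rpow_zero, one_mul]

/-- A convexity-free replacement for Minkowski's inequality: a summable weight turns a series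
into a supremum, and hence, for every exponent `r > 0`, into a series of `r`-th powers. -/
theorem tsum_mul_rpow_le (σ v : ℕ → ℝ≥0∞) {r : ℝ} (hr : 0 < r) :
    (∑' k, σ k * v k) ^ r ≤ (∑' k, σ k) ^ r * ∑' k, v k ^ r := by
  have h1 : ∀ k, v k ≤ (∑' k, v k ^ r) ^ r⁻¹ := fun k => by
    rw [ENNReal.le_rpow_inv_iff hr]
    exact ENNReal.le_tsum (f := fun k => v k ^ r) k
  calc (∑' k, σ k * v k) ^ r ≤ (∑' k, σ k * (∑' k, v k ^ r) ^ r⁻¹) ^ r := by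
        gcongr with k; exact h1 k
    _ = _ := by
        rw [ENNReal.tsum_mul_right, ENNReal.mul_rpow_of_nonneg _ _ hr.le,
          ENNReal.rpow_inv_rpow hr.ne']

/-- The quasi-triangle inequality for series, in all `L^s` with `0 < s ≤ ∞`, at the cost of a
geometric weight. -/
theorem eLpNorm_tsum_le {s : ℝ≥0∞} (hs : s ≠ 0) {ρ : ℝ≥0} (hρ : ρ < 1) :
    ∃ K : ℝ≥0, ∀ {X : Type} [MeasurableSpace X] (ν : Measure X) (u : ℕ → X → ℝ≥0∞) (A : ℝ≥0∞),
      (∀ k, Measurable (u k)) → (∀ k, eLpNorm (u k) s ν ≤ ρ ^ k * A) →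
      eLpNorm (fun x => ∑' k, u k x) s ν ≤ K * A := by
  obtain ⟨σ, hσ1, hσ2⟩ : ∃ σ : ℝ≥0, ρ < σ ∧ σ < 1 := exists_between hρ
  have hσ0 : 0 < σ := zero_le.trans_lt hσ1
  have geo : ∀ a : ℝ≥0, a < 1 → ∑' k : ℕ, (a : ℝ≥0∞) ^ k ≠ ∞ := by
    intro a ha
    rw [ENNReal.tsum_geometric]
    refine ENNReal.inv_ne_top.2 ?_
    simpa [tsub_eq_zero_iff_le] using ha
  have hS : ∑' k : ℕ, (σ : ℝ≥0∞) ^ k ≠ ∞ := geo σ hσ2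
  rcases eq_or_ne s ∞ with rfl | hs'
  · refine ⟨(∑' k : ℕ, (ρ : ℝ≥0∞) ^ k).toNNReal, fun {X} _ ν u A hu hA => ?_⟩
    rw [ENNReal.coe_toNNReal (geo ρ hρ), ← ENNReal.tsum_mul_right, eLpNorm_exponent_top]
    refine eLpNormEssSup_le_of_ae_enorm_bound ?_
    have h1 : ∀ k, ∀ᵐ x ∂ν, u k x ≤ (ρ : ℝ≥0∞) ^ k * A := fun k => by
      have := enorm_ae_le_eLpNormEssSup (u k) ν
      filter_upwards [this] with x hx
      exact hx.trans (by simpa using hA k)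
    filter_upwards [ae_all_iff.2 h1] with x hx
    exact ENNReal.tsum_le_tsum hx
  · set r := s.toReal with hr_def
    have hr : 0 < r := ENNReal.toReal_pos hs hs'
    set τ : ℝ≥0 := ρ / σ with hτ
    have hτ1 : τ ^ r < 1 := by
      apply NNReal.rpow_lt_one _ hr
      rw [hτ, div_lt_one hσ0]; exact hσ1
    set T := ∑' k : ℕ, ((τ ^ r : ℝ≥0) : ℝ≥0∞) ^ k
    have hT : T ≠ ∞ := geo _ hτ1
    set S := ∑' k : ℕ, (σ : ℝ≥0∞) ^ k
    have hK : S * T ^ (1 / r) ≠ ∞ := by finiteness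
    refine ⟨(S * T ^ (1 / r)).toNNReal, fun {X} _ ν u A hu hA => ?_⟩
    rw [ENNReal.coe_toNNReal hK]
    have hInt : ∀ k, ∫⁻ x, u k x ^ r ∂ν ≤ ((ρ : ℝ≥0∞) ^ k * A) ^ r := fun k => by
      have := hA k
      rw [eLpNorm_eq_lintegral_rpow_enorm_toReal hs hs'] at this
      simp only [enorm_eq_self] at this
      rw [← hr_def, one_div, ENNReal.rpow_inv_le_iff hr] at this
      exact this
    rw [eLpNorm_eq_lintegral_rpow_enorm_toReal hs hs', ← hr_def, one_div,
      ENNReal.rpow_inv_le_iff hr]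
    simp only [enorm_eq_self]
    have hσne : ∀ k : ℕ, (σ : ℝ≥0∞) ^ k ≠ 0 := fun k => pow_ne_zero _ (by simpa using hσ0.ne')
    have hσnt : ∀ k : ℕ, (σ : ℝ≥0∞) ^ k ≠ ∞ := fun k => by finiteness
    have h2 : ∀ x, (∑' k, u k x) ^ r ≤ S ^ r * ∑' k, (((σ : ℝ≥0∞) ^ k)⁻¹ * u k x) ^ r := by
      intro x
      have := tsum_mul_rpow_le (fun k => (σ : ℝ≥0∞) ^ k)
        (fun k => ((σ : ℝ≥0∞) ^ k)⁻¹ * u k x) hr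
      simp only [← mul_assoc, ENNReal.mul_inv_cancel (hσne _) (hσnt _), one_mul] at this
      exact this
    calc ∫⁻ x, (∑' k, u k x) ^ r ∂ν
        ≤ ∫⁻ x, S ^ r * ∑' k, (((σ : ℝ≥0∞) ^ k)⁻¹ * u k x) ^ r ∂ν := lintegral_mono h2
      _ = S ^ r * ∑' k, ∫⁻ x, (((σ : ℝ≥0∞) ^ k)⁻¹ * u k x) ^ r ∂ν := by
          rw [lintegral_const_mul _ (by fun_prop), lintegral_tsum (fun k => by fun_prop)]
      _ ≤ S ^ r * ∑' k, ((τ ^ r : ℝ≥0) : ℝ≥0∞) ^ k * A ^ r := by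
          gcongr with k
          simp only [ENNReal.mul_rpow_of_nonneg _ _ hr.le]
          rw [lintegral_const_mul _ (by fun_prop)]
          refine (mul_le_mul_right (hInt k) _).trans (le_of_eq ?_)
          rw [ENNReal.mul_rpow_of_nonneg _ _ hr.le, ← mul_assoc,
            ← ENNReal.mul_rpow_of_nonneg _ _ hr.le]
          congr 1
          rw [mul_comm, ← div_eq_mul_inv, ← ENNReal.coe_pow, ← ENNReal.coe_pow,
            ← ENNReal.coe_div (pow_ne_zero _ hσ0.ne'), ← div_pow,
            ← ENNReal.coe_rpow_of_nonneg _ hr.le, ← ENNReal.coe_pow, ENNReal.coe_inj,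
            ← NNReal.rpow_natCast, ← NNReal.rpow_natCast, ← NNReal.rpow_mul,
            ← NNReal.rpow_mul, mul_comm]
      _ = (S * T ^ r⁻¹ * A) ^ r := by
          rw [ENNReal.tsum_mul_right, ENNReal.mul_rpow_of_nonneg _ _ hr.le,
            ENNReal.mul_rpow_of_nonneg _ _ hr.le, ENNReal.rpow_inv_rpow hr.ne', mul_assoc]

/-- Dilations act on the weighted norm by powers, so a function dominated by a series of
dilates of `g` with geometrically decaying norms has norm controlled by that of `g`. -/
theorem wNorm_le_of_le_tsum_dilation {q : ℝ} {s : ℝ≥0∞} (hs : s ≠ 0) {a b : ℕ → ℝ}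
    (ha : ∀ k, 0 ≤ a k) (hb : ∀ k, 0 < b k) {C ρ : ℝ} (hρ : 0 ≤ ρ) (hρ1 : ρ < 1)
    (hab : ∀ k, a k * b k ^ (-(1 / q)) ≤ C * ρ ^ k) :
    ∃ K : ℝ≥0, ∀ F g : ℝ → ℝ≥0∞, Measurable g →
      (∀ t, 0 < t → F t ≤ ∑' k, ENNReal.ofReal (a k) * g (b k * t)) →
      wNorm q s F ≤ K * wNorm q s g := by
  lift ρ to ℝ≥0 using hρ
  obtain ⟨K, hK⟩ := eLpNorm_tsum_le hs (ρ := ρ) (by exact_mod_cast hρ1)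
  refine ⟨K * C.toNNReal, fun F g hg hF => (wNorm_mono hF).trans ?_⟩
  have h := hK haarPos (fun k t => ENNReal.ofReal (t ^ (1 / q)) *
    (ENNReal.ofReal (a k) * g (b k * t))) (ENNReal.ofReal C * wNorm q s g)
    (fun k => by fun_prop) (fun k => ?_)
  · rw [ENNReal.coe_mul, mul_assoc]
    refine le_trans (le_of_eq ?_) h
    unfold wNorm
    simp only [ENNReal.tsum_mul_left]
  · change wNorm q s (fun t => ((a k).toNNReal : ℝ≥0∞) * g (b k * t)) ≤ _
    refine (wNorm_const_mul_le s _ _).trans ?_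
    refine (mul_le_mul_right (wNorm_comp_mul_le s (hb k) hg) _).trans ?_
    change ENNReal.ofReal (a k) * (_ * wNorm q s g) ≤ _
    rw [← mul_assoc, ← mul_assoc, ← ENNReal.ofReal_mul (ha k)]
    refine mul_le_mul_left ?_ _
    refine (ENNReal.ofReal_le_ofReal (hab k)).trans (le_of_eq ?_)
    rw [mul_comm, ENNReal.ofReal_mul (by positivity), ENNReal.ofReal_pow (by positivity),
      ENNReal.ofReal_coe_nnreal]

theorem wNorm_le_of_le_dilation {q : ℝ} {s : ℝ≥0∞} (hs : s ≠ 0) {a b : ℝ}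
    (ha : 0 ≤ a) (hb : 0 < b) :
    ∃ K : ℝ≥0, ∀ F g : ℝ → ℝ≥0∞, Measurable g →
      (∀ t, 0 < t → F t ≤ ENNReal.ofReal a * g (b * t)) →
      wNorm q s F ≤ K * wNorm q s g := by
  obtain ⟨K, hK⟩ := wNorm_le_of_le_tsum_dilation (q := q) hs (a := fun k => if k = 0 then a else 0)
    (b := fun _ => b) (C := a * b ^ (-(1 / q))) (ρ := 0)
    (fun k => by split_ifs <;> simp [ha]) (fun _ => hb) le_rfl one_pos (fun k => by
      split_ifs with hk <;> simp [hk])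
  refine ⟨K, fun F g hg hF => hK F g hg fun t ht => (hF t ht).trans ?_⟩
  refine le_trans (by simp) (ENNReal.le_tsum 0)

theorem wNorm_add_le (q : ℝ) (s : ℝ≥0∞) :
    ∃ K : ℝ≥0, ∀ f g : ℝ → ℝ≥0∞, Measurable f → Measurable g →
      wNorm q s (fun t => f t + g t) ≤ K * (wNorm q s f + wNorm q s g) := by
  refine ⟨(ENNReal.LpAddConst s).toNNReal, fun f g hf hg => ?_⟩
  rw [ENNReal.coe_toNNReal (ENNReal.LpAddConst_lt_top s).ne]
  refine le_trans (le_of_eq ?_) (eLpNorm_add_le' (p := s) (μ := haarPos)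
    (f := fun t : ℝ => ENNReal.ofReal (t ^ (1 / q)) * f t)
    (g := fun t : ℝ => ENNReal.ofReal (t ^ (1 / q)) * g t)
    (by fun_prop : Measurable _).aestronglyMeasurable
    (by fun_prop : Measurable _).aestronglyMeasurable)
  unfold wNorm
  congr 1
  funext t
  simp [mul_add]

end WeightedNorm

/-! ### Hardy's inequality for rearrangements -/

section Hardy

variable {X : Type*} [MeasurableSpace X] {ν : Measure X}

theorem decrRearr_le_maxRearr (f : X → ℝ≥0∞) {t : ℝ} (ht : 0 < t) :
    decrRearr ν f t ≤ maxRearr ν f t := by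
  unfold maxRearr
  rw [ENNReal.le_div_iff_mul_le (by simp [ht]) (by simp)]
  calc decrRearr ν f t * ENNReal.ofReal t = ∫⁻ _ in Ioo (0 : ℝ) t, decrRearr ν f t := by simp
    _ ≤ _ := setLIntegral_mono' measurableSet_Ioo fun τ hτ => decrRearr_antitone f hτ.2.le

theorem Ioo_zero_subset_iUnion_Ioc {t : ℝ} :
    Ioo 0 t ⊆ ⋃ k : ℕ, Ioc (t * (1 / 2) ^ (k + 1)) (t * (1 / 2) ^ k) := by
  intro τ hτ
  have ht : 0 < t := hτ.1.trans hτ.2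
  obtain ⟨n, h1, h2⟩ := exists_nat_pow_near_of_lt_one (x := τ / t) (y := 1 / 2)
    (div_pos hτ.1 ht) ((div_le_one ht).2 hτ.2.le) (by norm_num) (by norm_num)
  refine mem_iUnion.2 ⟨n, ?_, ?_⟩
  · rwa [lt_div_iff₀ ht, mul_comm] at h1
  · rwa [div_le_iff₀ ht, mul_comm] at h2

/-- The average `f^{**}` as a dyadic series of dilates of `f^*`. -/
theorem maxRearr_le_tsum (f : X → ℝ≥0∞) {t : ℝ} (ht : 0 < t) :
    maxRearr ν f t ≤
      ∑' k : ℕ, ENNReal.ofReal ((1 / 2) ^ (k + 1)) * decrRearr ν f ((1 / 2) ^ (k + 1) * t) := by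
  unfold maxRearr
  rw [ENNReal.div_le_iff (by simp [ht]) (by simp), ← ENNReal.tsum_mul_right]
  calc ∫⁻ τ in Ioo (0 : ℝ) t, decrRearr ν f τ
      ≤ ∫⁻ τ in ⋃ k : ℕ, Ioc (t * (1 / 2) ^ (k + 1)) (t * (1 / 2) ^ k), decrRearr ν f τ :=
        lintegral_mono_set Ioo_zero_subset_iUnion_Ioc
    _ ≤ ∑' k : ℕ, ∫⁻ τ in Ioc (t * (1 / 2) ^ (k + 1)) (t * (1 / 2) ^ k), decrRearr ν f τ :=
        lintegral_iUnion_le _ _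
    _ ≤ _ := by
        gcongr with k
        calc _ ≤ ∫⁻ _ in Ioc (t * (1 / 2) ^ (k + 1)) (t * (1 / 2) ^ k),
              decrRearr ν f ((1 / 2) ^ (k + 1) * t) :=
              setLIntegral_mono' measurableSet_Ioc fun τ hτ =>
                decrRearr_antitone f (by rw [mul_comm]; exact hτ.1.le)
          _ = _ := by
              rw [setLIntegral_const, Real.volume_Ioc, mul_comm, mul_right_comm,
                ← ENNReal.ofReal_mul (by positivity)]
              congr 2
              ring

theorem wNorm_le_lorentzNorm (q : ℝ) (s : ℝ≥0∞) (f : X → ℝ≥0∞) :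
    wNorm q s (decrRearr ν f) ≤ lorentzNorm ν q s f := by
  unfold lorentzNorm
  split_ifs with hq
  · exact wNorm_mono fun t ht => decrRearr_le_maxRearr f ht
  · exact le_rfl

/-- Hardy's inequality: for `q > 1` the Lorentz norms defined through `f^{**}` and `f^*` are
equivalent, for every `0 < s ≤ ∞`. -/
theorem lorentzNorm_le_wNorm (q : ℝ) {s : ℝ≥0∞} (hs : s ≠ 0) :
    ∃ K : ℝ≥0, ∀ {X : Type*} [MeasurableSpace X] (ν : Measure X) (f : X → ℝ≥0∞),
      lorentzNorm ν q s f ≤ K * wNorm q s (decrRearr ν f) := by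
  by_cases hq : 1 < q
  · have hq0 : 0 < q := one_pos.trans hq
    have he : 0 < 1 - 1 / q := by rw [sub_pos, div_lt_one hq0]; exact hq
    obtain ⟨K, hK⟩ := wNorm_le_of_le_tsum_dilation (q := q) hs
      (a := fun k => (1 / 2) ^ (k + 1)) (b := fun k => (1 / 2) ^ (k + 1))
      (C := 1) (ρ := (1 / 2) ^ (1 - 1 / q)) (fun k => by positivity) (fun k => by positivity)
      (by positivity) (Real.rpow_lt_one (by norm_num) (by norm_num) he) (fun k => by
        rw [one_mul, ← Real.rpow_natCast (((1 : ℝ) / 2) ^ (1 - 1 / q)), ← Real.rpow_mul (by norm_num),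
          mul_comm (1 - 1 / q), Real.rpow_mul (by norm_num), Real.rpow_natCast]
        calc ((1 : ℝ) / 2) ^ (k + 1) * ((1 / 2) ^ (k + 1)) ^ (-(1 / q))
            = (((1 : ℝ) / 2) ^ (k + 1)) ^ (1 - 1 / q) := by
              rw [sub_eq_add_neg, Real.rpow_add (by positivity), Real.rpow_one]
          _ ≤ _ := by
              apply Real.rpow_le_rpow (by positivity) _ he.le
              exact pow_le_pow_of_le_one (by norm_num) (by norm_num) (Nat.le_succ k))
    refine ⟨K, fun ν f => ?_⟩
    unfold lorentzNorm
    rw [if_pos hq]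
    exact hK _ _ (decrRearr_measurable f) fun t ht => maxRearr_le_tsum f ht
  · refine ⟨1, fun ν f => ?_⟩
    unfold lorentzNorm
    rw [if_neg hq, ENNReal.coe_one, one_mul]
    exact le_rfl

end Hardy

/-! ### The maximal function: doubling and domination by the Wolff potential -/

section Doubling

variable {N : ℕ}

/-- The truncated Wolff potential in terms of the order `β = α p` and the exponent
`θ = 1 / (p - 1)`. For `θ = 1` it is a truncated Riesz potential of order `β`. -/
noncomputable def truncWolff (β θ : ℝ) (R : ℝ≥0∞) (μ : Measure (EuclideanSpace ℝ (Fin N)))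
    (x : EuclideanSpace ℝ (Fin N)) : ℝ≥0∞ :=
  ∫⁻ t in {t : ℝ | 0 < t ∧ ENNReal.ofReal t < R},
    (μ (Metric.ball x t) / ENNReal.ofReal (t ^ ((N : ℝ) - β))) ^ θ / ENNReal.ofReal t

theorem wolffPotential_eq_truncWolff (α p : ℝ) (R : ℝ≥0∞)
    (μ : Measure (EuclideanSpace ℝ (Fin N))) :
    wolffPotential α p R μ = truncWolff (α * p) (1 / (p - 1)) R μ := rfl

/-- A finite set of translations, containing `0`, that after scaling by `ρ` covers each ball
of radius `2 ρ` by translates of the concentric ball of radius `ρ / 2`. -/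
theorem exists_ball_cover (N : ℕ) : ∃ S : Finset (EuclideanSpace ℝ (Fin N)), 0 ∈ S ∧
    ∀ (x : EuclideanSpace ℝ (Fin N)) (ρ : ℝ), 0 < ρ →
      Metric.ball x (2 * ρ) ⊆ ⋃ z ∈ S, Metric.ball (x + ρ • z) (ρ / 2) := by
  classical
  obtain ⟨T, hT⟩ := (isCompact_closedBall (0 : EuclideanSpace ℝ (Fin N)) 2).elim_finite_subcover
    (fun z : EuclideanSpace ℝ (Fin N) => Metric.ball z (1 / 2)) (fun z => Metric.isOpen_ball)
    (fun z _ => mem_iUnion.2 ⟨z, by simp⟩)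
  refine ⟨insert 0 T, Finset.mem_insert_self _ _, fun x ρ hρ y hy => ?_⟩
  have h1 : ρ⁻¹ • (y - x) ∈ Metric.closedBall (0 : EuclideanSpace ℝ (Fin N)) 2 := by
    rw [mem_closedBall_zero_iff, norm_smul, norm_inv, Real.norm_of_nonneg hρ.le,
      inv_mul_le_iff₀ hρ, ← dist_eq_norm, mul_comm]
    exact (Metric.mem_ball.1 hy).le
  obtain ⟨z, hz, hyz⟩ := mem_iUnion₂.1 (hT h1)
  refine mem_iUnion₂.2 ⟨z, Finset.mem_insert_of_mem hz, ?_⟩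
  rw [Metric.mem_ball, dist_eq_norm] at hyz ⊢
  have h2 : y - (x + ρ • z) = ρ • (ρ⁻¹ • (y - x) - z) := by
    rw [smul_sub, smul_inv_smul₀ hρ.ne']; abel
  rw [h2, norm_smul, Real.norm_of_nonneg hρ.le]
  nlinarith

theorem measure_div_rpow_le_fracMaximal (β : ℝ) (R : ℝ≥0∞)
    (μ : Measure (EuclideanSpace ℝ (Fin N))) (x : EuclideanSpace ℝ (Fin N)) {t : ℝ} (ht : 0 < t)
    (htR : ENNReal.ofReal t < R) :
    μ (Metric.ball x t) / ENNReal.ofReal (t ^ ((N : ℝ) - β)) ≤ fracMaximal β R μ x :=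
  le_iSup_of_le t (le_iSup_of_le ht (le_iSup_of_le htR le_rfl))

/-- Doubling the truncation radius changes the rearrangement of the maximal function, and of the
measure of balls, only by a dimensional factor: a ball of radius `2 ρ` is covered by boundedly many
translates of the concentric ball of radius `ρ / 2`, and rearrangements ignore translations. -/
theorem exists_decrRearr_doubling (N : ℕ) : ∃ m : ℕ, 0 < m ∧
    (∀ (β : ℝ) (_ : β ≤ N) (R : ℝ≥0∞) (μ : Measure (EuclideanSpace ℝ (Fin N))) (t : ℝ), 0 ≤ t →
      decrRearr volume (fracMaximal β (2 * R) μ) (m * t) ≤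
        m * decrRearr volume (fracMaximal β R μ) t) ∧
    (∀ (μ : Measure (EuclideanSpace ℝ (Fin N))) (ρ t : ℝ), 0 < ρ →
      decrRearr volume (fun x => μ (Metric.ball x (2 * ρ))) (m * t) ≤
        m * decrRearr volume (fun x => μ (Metric.ball x ρ)) t) := by
  obtain ⟨S, h0, hS⟩ := exists_ball_cover N
  have hm : 0 < S.card := Finset.card_pos.2 ⟨0, h0⟩
  have hcov : ∀ (μ : Measure (EuclideanSpace ℝ (Fin N))) (x : EuclideanSpace ℝ (Fin N)) (ρ : ℝ),
      0 < ρ → μ (Metric.ball x (2 * ρ)) ≤ ∑ z ∈ S, μ (Metric.ball (x + ρ • z) (ρ / 2)) :=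
    fun μ x ρ hρ => (measure_mono (hS x ρ hρ)).trans (measure_biUnion_finset_le _ _)
  have htrans : ∀ (f : EuclideanSpace ℝ (Fin N) → ℝ≥0∞) (ρ t : ℝ),
      decrRearr volume (fun x => ∑ z ∈ S, f (x + ρ • z)) (S.card * t) ≤
        S.card * decrRearr volume f t := fun f ρ t =>
    decrRearr_finset_sum_le S (fun z x => f (x + ρ • z)) fun z _ =>
      (decrRearr_comp_add_right volume f (ρ • z) t).le
  refine ⟨S.card, hm, fun β hβ R μ t ht => ?_, fun μ ρ t hρ => ?_⟩
  · rcases eq_or_ne R ∞ with rfl | hR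
    · rw [ENNReal.mul_top (by norm_num)]
      have h1 : (1 : ℝ) ≤ S.card := by exact_mod_cast hm
      have h2 : (1 : ℝ≥0∞) ≤ S.card := by exact_mod_cast hm
      refine (decrRearr_antitone _ (le_mul_of_one_le_left ht h1)).trans ?_
      exact le_mul_of_one_le_left zero_le h2
    · refine (decrRearr_mono (fun x => ?_) _).trans (htrans _ R.toReal t)
      refine iSup_le fun τ => iSup_le fun hτ => iSup_le fun hτR => ?_
      have hsingle : ∀ z ∈ S, fracMaximal β R μ (x + R.toReal • z) ≤
          ∑ z ∈ S, fracMaximal β R μ (x + R.toReal • z) := fun z hz =>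
        Finset.single_le_sum (f := fun z => fracMaximal β R μ (x + R.toReal • z))
          (fun _ _ => zero_le) hz
      rcases lt_or_ge (ENNReal.ofReal τ) R with h | h
      · refine le_trans ?_ (hsingle 0 h0)
        rw [smul_zero, add_zero]
        exact measure_div_rpow_le_fracMaximal β R μ x hτ h
      · lift R to ℝ≥0 using hR
        have hRτ : (R : ℝ) ≤ τ := by
          rw [← ENNReal.ofReal_coe_nnreal] at h
          exact (ENNReal.ofReal_le_ofReal_iff hτ.le).1 h
        have hτ2 : τ < 2 * R := by
          rw [← ENNReal.ofReal_coe_nnreal, ← ENNReal.ofReal_ofNat,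
            ← ENNReal.ofReal_mul (by norm_num)] at hτR
          exact (ENNReal.ofReal_lt_ofReal_iff_of_nonneg hτ.le).1 hτR
        have hR0 : (0 : ℝ) < R := by linarith
        simp only [ENNReal.coe_toReal]
        calc μ (Metric.ball x τ) / ENNReal.ofReal (τ ^ ((N : ℝ) - β))
            ≤ (∑ z ∈ S, μ (Metric.ball (x + (R : ℝ) • z) (R / 2))) /
                ENNReal.ofReal (((R : ℝ) / 2) ^ ((N : ℝ) - β)) := by
              apply ENNReal.div_le_div
              · exact (measure_mono (Metric.ball_subset_ball hτ2.le)).trans (hcov μ x R hR0)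
              · apply ENNReal.ofReal_le_ofReal
                apply Real.rpow_le_rpow <;> linarith
          _ = ∑ z ∈ S, μ (Metric.ball (x + (R : ℝ) • z) (R / 2)) /
                ENNReal.ofReal (((R : ℝ) / 2) ^ ((N : ℝ) - β)) := by
              simp only [div_eq_mul_inv, Finset.sum_mul]
          _ ≤ _ := by
              refine Finset.sum_le_sum fun z _ => ?_
              refine measure_div_rpow_le_fracMaximal β R μ _ (by linarith) ?_
              rw [← ENNReal.ofReal_coe_nnreal]
              exact (ENNReal.ofReal_lt_ofReal_iff hR0).2 (by linarith)
  · refine (decrRearr_mono (fun x => ?_) _).trans (htrans _ ρ t)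
    refine (hcov μ x ρ hρ).trans (Finset.sum_le_sum fun z _ => measure_mono ?_)
    exact Metric.ball_subset_ball (by linarith)

/-- The scales between `t` and `2 t` in the Wolff potential already see the ball of radius `t`. -/
theorem exists_fracMaximal_rpow_le_truncWolff {β θ : ℝ} (hβ : β ≤ N) (hθ : 0 < θ) :
    ∃ C : ℝ≥0, ∀ (R : ℝ≥0∞) (μ : Measure (EuclideanSpace ℝ (Fin N)))
      (x : EuclideanSpace ℝ (Fin N)),
      fracMaximal β R μ x ^ θ ≤ C * truncWolff β θ (2 * R) μ x := by
  set d := (N : ℝ) - β with hd_def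
  have hd : 0 ≤ d := sub_nonneg.2 hβ
  set A : ℝ := (2 : ℝ) ^ (d * θ) * 2
  have hA : 0 < A := by positivity
  refine ⟨A.toNNReal, fun R μ x => ?_⟩
  change _ ≤ ENNReal.ofReal A * _
  rw [← ENNReal.le_rpow_inv_iff hθ]
  refine iSup_le fun t => iSup_le fun ht => iSup_le fun htR => ?_
  rw [ENNReal.le_rpow_inv_iff hθ]
  set m := μ (Metric.ball x t)
  have key : ENNReal.ofReal A * ((m / ENNReal.ofReal ((2 * t) ^ d)) ^ θ / ENNReal.ofReal (2 * t) *
      ENNReal.ofReal t) = (m / ENNReal.ofReal (t ^ d)) ^ θ := by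
    rw [ENNReal.div_rpow_of_nonneg _ _ hθ.le, ENNReal.div_rpow_of_nonneg _ _ hθ.le,
      ENNReal.ofReal_rpow_of_pos (by positivity), ENNReal.ofReal_rpow_of_pos (by positivity)]
    simp only [div_eq_mul_inv]
    rw [← ENNReal.ofReal_inv_of_pos (by positivity), ← ENNReal.ofReal_inv_of_pos (by positivity),
      ← ENNReal.ofReal_inv_of_pos (by positivity), mul_assoc, mul_assoc,
      ← ENNReal.ofReal_mul (by positivity), ← ENNReal.ofReal_mul (by positivity), mul_left_comm,
      ← ENNReal.ofReal_mul (by positivity)]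
    congr 2
    rw [Real.mul_rpow (by norm_num) ht.le, Real.mul_rpow (by positivity) (by positivity),
      ← Real.rpow_mul (by norm_num)]
    simp only [A]
    field_simp
  rw [← key]
  refine mul_le_mul_right ?_ _
  calc _ = ∫⁻ _ in Ioo t (2 * t), (m / ENNReal.ofReal ((2 * t) ^ d)) ^ θ /
        ENNReal.ofReal (2 * t) := by
        rw [setLIntegral_const, Real.volume_Ioo]; congr 2; ring
    _ ≤ ∫⁻ u in Ioo t (2 * t), (μ (Metric.ball x u) / ENNReal.ofReal (u ^ d)) ^ θ /
        ENNReal.ofReal u := by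
        refine setLIntegral_mono' measurableSet_Ioo fun u hu => ?_
        have hu0 : 0 < u := ht.trans hu.1
        refine ENNReal.div_le_div (ENNReal.rpow_le_rpow (ENNReal.div_le_div ?_ ?_) hθ.le) ?_
        · exact measure_mono (Metric.ball_subset_ball hu.1.le)
        · exact ENNReal.ofReal_le_ofReal (Real.rpow_le_rpow hu0.le hu.2.le hd)
        · exact ENNReal.ofReal_le_ofReal hu.2.le
    _ ≤ _ := by
        refine lintegral_mono_set fun u hu => ⟨ht.trans hu.1, ?_⟩
        refine lt_of_le_of_lt (ENNReal.ofReal_le_ofReal hu.2.le) ?_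
        rw [ENNReal.ofReal_mul (by norm_num), ENNReal.ofReal_ofNat]
        exact ENNReal.mul_lt_mul_right (by norm_num) (by norm_num) htR

/-- The maximal function is dominated by the Wolff potential, on the level of rearrangements. -/
theorem exists_decrRearr_fracMaximal_le_truncWolff {β θ : ℝ} (hβ : β ≤ N) (hθ : 0 < θ) :
    ∃ C : ℝ≥0, ∃ c : ℝ, 0 < c ∧ ∀ (R : ℝ≥0∞) (μ : Measure (EuclideanSpace ℝ (Fin N))) (t : ℝ),
      0 < t → decrRearr volume (fracMaximal β R μ) t ^ θ ≤
        C * decrRearr volume (truncWolff β θ R μ) (c * t) := by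
  obtain ⟨m, hm, hM, -⟩ := exists_decrRearr_doubling N
  obtain ⟨C, hC⟩ := exists_fracMaximal_rpow_le_truncWolff (N := N) hβ hθ
  have hm0 : (0 : ℝ) < m := by exact_mod_cast hm
  refine ⟨(m : ℝ≥0) ^ θ * C, (m : ℝ)⁻¹, by positivity, fun R μ t ht => ?_⟩
  have hR : 2 * (R / 2) = R := ENNReal.mul_div_cancel (by norm_num) (by norm_num)
  have h1 := hM β hβ (R / 2) μ ((m : ℝ)⁻¹ * t) (by positivity)
  rw [mul_inv_cancel_left₀ hm0.ne', hR] at h1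
  have h2 : decrRearr volume (fracMaximal β (R / 2) μ) ((m : ℝ)⁻¹ * t) ^ θ ≤
      C * decrRearr volume (truncWolff β θ R μ) ((m : ℝ)⁻¹ * t) := by
    rw [← decrRearr_rpow _ hθ]
    refine (decrRearr_mono (fun x => ?_) _).trans (decrRearr_const_mul_le _ _ _)
    have := hC (R / 2) μ x
    rwa [hR] at this
  calc _ ≤ ((m : ℝ≥0∞) * decrRearr volume (fracMaximal β (R / 2) μ) ((m : ℝ)⁻¹ * t)) ^ θ :=
        ENNReal.rpow_le_rpow h1 hθ.le
    _ ≤ (m : ℝ≥0∞) ^ θ * (C * decrRearr volume (truncWolff β θ R μ) ((m : ℝ)⁻¹ * t)) := by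
        rw [ENNReal.mul_rpow_of_nonneg _ _ hθ.le]
        exact mul_le_mul_right h2 _
    _ = _ := by
        rw [← mul_assoc, ENNReal.coe_mul, ENNReal.coe_rpow_of_nonneg _ hθ.le]; simp

/-- Iterated doubling of the truncation radius of the maximal function. -/
theorem decrRearr_fracMaximal_two_pow_le {m : ℕ} {β : ℝ} {R : ℝ≥0∞}
    {μ : Measure (EuclideanSpace ℝ (Fin N))}
    (hM : ∀ (R : ℝ≥0∞) (t : ℝ), 0 ≤ t → decrRearr volume (fracMaximal β (2 * R) μ) (m * t) ≤
        m * decrRearr volume (fracMaximal β R μ) t) (k : ℕ) {t : ℝ} (ht : 0 ≤ t) :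
    decrRearr volume (fracMaximal β (2 ^ k * R) μ) (m ^ k * t) ≤
        m ^ k * decrRearr volume (fracMaximal β R μ) t := by
  induction k with
  | zero => simp
  | succ k ih =>
    rw [pow_succ', pow_succ', pow_succ', mul_assoc, mul_assoc, mul_assoc]
    exact (hM _ _ (by positivity)).trans (mul_le_mul_right ih _)

theorem decrRearr_measure_ball_two_pow_le {m : ℕ} {μ : Measure (EuclideanSpace ℝ (Fin N))}
    (hM : ∀ (ρ t : ℝ), 0 < ρ → decrRearr volume (fun x => μ (Metric.ball x (2 * ρ))) (m * t) ≤
        m * decrRearr volume (fun x => μ (Metric.ball x ρ)) t) {ρ : ℝ} (hρ : 0 < ρ) (k : ℕ)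
    (t : ℝ) :
    decrRearr volume (fun x => μ (Metric.ball x (2 ^ k * ρ))) (m ^ k * t) ≤
        m ^ k * decrRearr volume (fun x => μ (Metric.ball x ρ)) t := by
  induction k with
  | zero => simp
  | succ k ih =>
    rw [pow_succ', pow_succ', pow_succ', mul_assoc, mul_assoc, mul_assoc]
    exact (hM _ _ (by positivity)).trans (mul_le_mul_right ih _)

end Doubling

/-! ### Integrals of powers -/

section PowerIntegrals

theorem lintegral_Ioi_rpow {a c : ℝ} (ha : a < -1) (hc : 0 < c) :
    ∫⁻ t in Ioi c, ENNReal.ofReal (t ^ a) = ENNReal.ofReal (-c ^ (a + 1) / (a + 1)) := by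
  rw [← integral_Ioi_rpow_of_lt ha hc,
    ofReal_integral_eq_lintegral_ofReal (integrableOn_Ioi_rpow_of_lt ha hc)]
  filter_upwards [ae_restrict_mem measurableSet_Ioi] with t ht
  exact Real.rpow_nonneg (hc.le.trans (le_of_lt ht)) _

theorem lintegral_Ioo_zero_rpow {a r : ℝ} (ha : -1 < a) (hr : 0 ≤ r) :
    ∫⁻ t in Ioo 0 r, ENNReal.ofReal (t ^ a) = ENNReal.ofReal (r ^ (a + 1) / (a + 1)) := by
  have hint : IntervalIntegrable (fun t : ℝ => t ^ a) volume 0 r :=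
    intervalIntegral.intervalIntegrable_rpow' ha
  have h1 : ∫ t in (0 : ℝ)..r, t ^ a = r ^ (a + 1) / (a + 1) := by
    rw [integral_rpow (Or.inl ha), Real.zero_rpow (by linarith), sub_zero]
  rw [← h1, intervalIntegral.integral_of_le hr, integral_Ioc_eq_integral_Ioo,
    ofReal_integral_eq_lintegral_ofReal]
  · exact (hint.1).mono_set Ioo_subset_Ioc_self
  · filter_upwards [ae_restrict_mem measurableSet_Ioo] with t ht
    exact Real.rpow_nonneg ht.1.le _

end PowerIntegrals

/-! ### The Wolff potential at small scales -/

section LocalEstimate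

variable {N : ℕ}

theorem wolff_integrand_eq (m : ℝ≥0∞) {d θ t : ℝ} (hθ : 0 ≤ θ) (ht : 0 < t) :
    (m / ENNReal.ofReal (t ^ d)) ^ θ / ENNReal.ofReal t =
      m ^ θ * ENNReal.ofReal (t ^ (-(d * θ) - 1)) := by
  rw [ENNReal.div_rpow_of_nonneg _ _ hθ, ENNReal.ofReal_rpow_of_pos (by positivity),
    div_eq_mul_inv, div_eq_mul_inv, ← ENNReal.ofReal_inv_of_pos (by positivity),
    ← ENNReal.ofReal_inv_of_pos ht, mul_assoc, ← ENNReal.ofReal_mul (by positivity),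
    ← Real.rpow_mul ht.le, ← Real.rpow_neg ht.le, ← Real.rpow_neg_one t, ← Real.rpow_add ht]
  rfl

theorem truncWolff_ofReal {β θ : ℝ} (hθ : 0 ≤ θ) (R : ℝ)
    (μ : Measure (EuclideanSpace ℝ (Fin N))) (x : EuclideanSpace ℝ (Fin N)) :
    truncWolff β θ (ENNReal.ofReal R) μ x = ∫⁻ t in Ioo 0 R,
      μ (Metric.ball x t) ^ θ * ENNReal.ofReal (t ^ (-(((N : ℝ) - β) * θ) - 1)) := by
  have hset : {t : ℝ | 0 < t ∧ ENNReal.ofReal t < ENNReal.ofReal R} = Ioo 0 R := by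
    ext t
    exact and_congr_right fun ht => ENNReal.ofReal_lt_ofReal_iff_of_nonneg (le_of_lt ht)
  unfold truncWolff
  rw [hset]
  exact setLIntegral_congr_fun measurableSet_Ioo fun t ht => wolff_integrand_eq _ hθ ht.1

theorem measurable_measure_ball (μ : Measure (EuclideanSpace ℝ (Fin N))) [SFinite μ] :
    Measurable fun p : EuclideanSpace ℝ (Fin N) × ℝ => μ (Metric.ball p.1 p.2) := by
  have hopen : IsOpen {w : (EuclideanSpace ℝ (Fin N) × ℝ) × EuclideanSpace ℝ (Fin N) |
      dist w.2 w.1.1 < w.1.2} := isOpen_lt (by fun_prop) (by fun_prop)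
  exact measurable_measure_prodMk_left hopen.measurableSet

/-- Tonelli's theorem for the measure of moving balls. -/
theorem setLIntegral_measure_ball_le (μ : Measure (EuclideanSpace ℝ (Fin N))) [SFinite μ]
    (x : EuclideanSpace ℝ (Fin N)) {ρ t ρ' : ℝ} (h : ρ + t ≤ ρ') :
    ∫⁻ y in Metric.closedBall x ρ, μ (Metric.ball y t) ≤
      μ (Metric.ball x ρ') * volume (Metric.ball (0 : EuclideanSpace ℝ (Fin N)) t) := by
  have hopen : IsOpen {w : EuclideanSpace ℝ (Fin N) × EuclideanSpace ℝ (Fin N) |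
      dist w.2 w.1 < t} := isOpen_lt (by fun_prop) (by fun_prop)
  have hm := hopen.measurableSet
  have h1 := Measure.prod_apply (μ := volume.restrict (Metric.closedBall x ρ)) (ν := μ) hm
  have h2 := Measure.prod_apply_symm (μ := volume.restrict (Metric.closedBall x ρ)) (ν := μ) hm
  calc ∫⁻ y in Metric.closedBall x ρ, μ (Metric.ball y t)
      = ∫⁻ z, (volume.restrict (Metric.closedBall x ρ)) ((fun y => (y, z)) ⁻¹'
          {w : EuclideanSpace ℝ (Fin N) × EuclideanSpace ℝ (Fin N) | dist w.2 w.1 < t}) ∂μ := by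
        rw [← h2, h1]; rfl
    _ ≤ ∫⁻ z, (Metric.ball x ρ').indicator
          (fun _ => volume (Metric.ball (0 : EuclideanSpace ℝ (Fin N)) t)) z ∂μ := by
        refine lintegral_mono fun z => ?_
        have hset : (fun y => (y, z)) ⁻¹'
          {w : EuclideanSpace ℝ (Fin N) × EuclideanSpace ℝ (Fin N) | dist w.2 w.1 < t} =
            Metric.ball z t := by
          ext y; simp [dist_comm]
        rw [hset, Measure.restrict_apply Metric.isOpen_ball.measurableSet]
        by_cases hz : z ∈ Metric.ball x ρ'
        · rw [indicator_of_mem hz]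
          refine (measure_mono inter_subset_left).trans (le_of_eq ?_)
          exact Measure.addHaar_ball_center volume z t
        · have : Metric.ball z t ∩ Metric.closedBall x ρ = ∅ := by
            ext y
            simp only [mem_inter_iff, Metric.mem_ball, Metric.mem_closedBall, mem_empty_iff_false,
              iff_false, not_and, not_le] at hz ⊢
            intro hy
            have := dist_triangle z y x
            rw [dist_comm z y] at this
            linarith
          simp [this]
    _ = _ := by
        rw [lintegral_indicator Metric.isOpen_ball.measurableSet, setLIntegral_const, mul_comm]

/-- The linear majorant of the part of the Wolff potential at scales below `r`. The weight
`(r / t) ^ (β / 2)` leaves room to absorb the exponent `θ`. -/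
noncomputable def localPotential (β r : ℝ) (μ : Measure (EuclideanSpace ℝ (Fin N)))
    (y : EuclideanSpace ℝ (Fin N)) : ℝ≥0∞ :=
  ∫⁻ t in Ioo 0 r, μ (Metric.ball y t) *
    ENNReal.ofReal (r ^ (β / 2) * t ^ (-((N : ℝ) - β) - β / 2 - 1))

theorem localPotential_measurable (β r : ℝ) (μ : Measure (EuclideanSpace ℝ (Fin N))) [SFinite μ] :
    Measurable (localPotential β r μ) := by
  unfold localPotential
  exact Measurable.lintegral_prod_right' (f := fun p : EuclideanSpace ℝ (Fin N) × ℝ =>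
    μ (Metric.ball p.1 p.2) *
      ENNReal.ofReal (r ^ (β / 2) * p.2 ^ (-((N : ℝ) - β) - β / 2 - 1)))
    ((measurable_measure_ball μ).mul (by fun_prop))

/-- Where the maximal function is at most `1`, the quantity `Y = μ(B_t) / t^d` is at most `1`, and
`Y ^ θ ≤ Y (r / t) ^ (β / 2) + (t / r) ^ (β θ / 2)` for every exponent `θ > 0`. -/
theorem truncWolff_le_localPotential {β θ : ℝ} (hβ : 0 < β) (hθ : 0 < θ) {r : ℝ} (hr : 0 < r)
    {μ : Measure (EuclideanSpace ℝ (Fin N))} {y : EuclideanSpace ℝ (Fin N)}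
    (hy : ∀ t, 0 < t → t < r → μ (Metric.ball y t) ≤ ENNReal.ofReal (t ^ ((N : ℝ) - β))) :
    truncWolff β θ (ENNReal.ofReal r) μ y ≤
      localPotential β r μ y + ENNReal.ofReal (2 / (β * θ)) := by
  set d := (N : ℝ) - β
  set ε := β / 2 * θ
  have hε : 0 < ε := by positivity
  have h1 : ∫⁻ t in Ioo 0 r, ENNReal.ofReal (r ^ (-ε)) * ENNReal.ofReal (t ^ (ε - 1)) =
      ENNReal.ofReal (2 / (β * θ)) := by
    rw [lintegral_const_mul _ (by fun_prop), lintegral_Ioo_zero_rpow (by linarith) hr.le,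
      ← ENNReal.ofReal_mul (by positivity), sub_add_cancel, mul_div_assoc', ← Real.rpow_add hr,
      neg_add_cancel, Real.rpow_zero]
    congr 1
    simp only [ε]; field_simp
  rw [← h1, localPotential, ← lintegral_add_right _ (by fun_prop), truncWolff_ofReal hθ.le]
  refine setLIntegral_mono' measurableSet_Ioo fun t ht => ?_
  have ht0 : 0 < t := ht.1
  set m := μ (Metric.ball y t)
  have hm : m ≤ ENNReal.ofReal (t ^ d) := hy t ht.1 ht.2
  rw [← ENNReal.ofReal_mul (by positivity)]
  have hmt : m ≠ ∞ := ne_top_of_le_ne_top ENNReal.ofReal_ne_top hm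
  obtain ⟨a, ha, ham⟩ : ∃ a : ℝ, 0 ≤ a ∧ m = ENNReal.ofReal a :=
    ⟨m.toReal, ENNReal.toReal_nonneg, (ENNReal.ofReal_toReal hmt).symm⟩
  rw [ham] at hm ⊢
  have had : a ≤ t ^ d := (ENNReal.ofReal_le_ofReal_iff (by positivity)).1 hm
  rw [ENNReal.ofReal_rpow_of_nonneg ha hθ.le, ← ENNReal.ofReal_mul (by positivity),
    ← ENNReal.ofReal_mul ha, ← ENNReal.ofReal_add (by positivity) (by positivity)]
  apply ENNReal.ofReal_le_ofReal
  rcases le_or_gt (a * t ^ (-d)) ((t / r) ^ (β / 2)) with h | h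
  · refine le_trans ?_ (le_add_of_nonneg_left (by positivity))
    calc a ^ θ * t ^ (-(d * θ) - 1) = (a * t ^ (-d)) ^ θ * t ^ (-1 : ℝ) := by
          rw [Real.mul_rpow ha (by positivity), ← Real.rpow_mul ht0.le, mul_assoc,
            ← Real.rpow_add ht0]
          congr 2; ring
      _ ≤ ((t / r) ^ (β / 2)) ^ θ * t ^ (-1 : ℝ) := by gcongr
      _ = _ := by
          rw [← Real.rpow_mul (by positivity), Real.div_rpow ht0.le hr.le, Real.rpow_neg hr.le,
            Real.rpow_sub ht0, Real.rpow_neg_one, Real.rpow_one]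
          simp only [ε]; field_simp
  · refine le_trans ?_ (le_add_of_nonneg_right (by positivity))
    have h2 : a ^ θ ≤ t ^ (d * θ) := by
      rw [Real.rpow_mul ht0.le]; exact Real.rpow_le_rpow ha had hθ.le
    calc a ^ θ * t ^ (-(d * θ) - 1) ≤ t ^ (d * θ) * t ^ (-(d * θ) - 1) := by gcongr
      _ = (t / r) ^ (β / 2) * (r ^ (β / 2) * t ^ (-(β / 2) - 1)) := by
          rw [← Real.rpow_add ht0, Real.div_rpow ht0.le hr.le]
          have : d * θ + (-(d * θ) - 1) = β / 2 + (-(β / 2) - 1) := by ring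
          rw [this, Real.rpow_add ht0]
          field_simp
      _ ≤ (a * t ^ (-d)) * (r ^ (β / 2) * t ^ (-(β / 2) - 1)) := by gcongr
      _ = _ := by
          have : -d - β / 2 - 1 = -d + (-(β / 2) - 1) := by ring
          rw [this, Real.rpow_add ht0]; ring

theorem setLIntegral_localPotential_le {β : ℝ} (hβ : 0 < β) {r : ℝ} (hr : 0 < r)
    (μ : Measure (EuclideanSpace ℝ (Fin N))) [SFinite μ] (x : EuclideanSpace ℝ (Fin N)) :
    ∫⁻ y in Metric.closedBall x (5 * r), localPotential β r μ y ≤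
      μ (Metric.ball x (6 * r)) * ENNReal.ofReal (2 / β * r ^ β) *
        volume (Metric.ball (0 : EuclideanSpace ℝ (Fin N)) 1) := by
  set d := (N : ℝ) - β with hd
  obtain ⟨v, hv⟩ : ∃ v, v = volume (Metric.ball (0 : EuclideanSpace ℝ (Fin N)) 1) := ⟨_, rfl⟩
  obtain ⟨m, hm⟩ : ∃ m, m = μ (Metric.ball x (6 * r)) := ⟨_, rfl⟩
  rw [← hv, ← hm]
  have hm2 : Measurable (Function.uncurry fun (y : EuclideanSpace ℝ (Fin N)) (t : ℝ) =>
      μ (Metric.ball y t) * ENNReal.ofReal (r ^ (β / 2) * t ^ (-d - β / 2 - 1))) :=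
    (measurable_measure_ball μ).mul (by fun_prop)
  have hpt : ∀ t ∈ Ioo 0 r, ∫⁻ y in Metric.closedBall x (5 * r), μ (Metric.ball y t) *
      ENNReal.ofReal (r ^ (β / 2) * t ^ (-d - β / 2 - 1)) ≤
      m * v * ENNReal.ofReal (r ^ (β / 2)) * ENNReal.ofReal (t ^ (β / 2 - 1)) := by
    intro t ht
    have ht0 : 0 < t := ht.1
    have hmt : Measurable fun y : EuclideanSpace ℝ (Fin N) => μ (Metric.ball y t) := by
      have h := (measurable_measure_ball μ).comp
        (measurable_prodMk_right : Measurable fun y : EuclideanSpace ℝ (Fin N) => (y, t))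
      exact h
    have hvol : volume (Metric.ball (0 : EuclideanSpace ℝ (Fin N)) t) =
        ENNReal.ofReal (t ^ (N : ℝ)) * v := by
      rw [Measure.addHaar_ball_of_pos volume _ ht0, finrank_euclideanSpace_fin, Real.rpow_natCast, hv]
    have h1 := setLIntegral_measure_ball_le μ x (ρ := 5 * r) (t := t) (ρ' := 6 * r)
      (by linarith [ht.2])
    rw [hvol, ← hm] at h1
    rw [lintegral_mul_const _ hmt]
    refine (mul_le_mul_left h1 _).trans (le_of_eq ?_)
    rw [ENNReal.ofReal_mul (p := r ^ (β / 2)) (by positivity)]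
    have h2 : t ^ (β / 2 - 1) = t ^ (N : ℝ) * t ^ (-d - β / 2 - 1) := by
      rw [← Real.rpow_add ht0]
      congr 1
      rw [hd]; ring
    rw [h2, ENNReal.ofReal_mul (p := t ^ (N : ℝ)) (by positivity)]
    ring
  calc ∫⁻ y in Metric.closedBall x (5 * r), localPotential β r μ y
      = ∫⁻ t in Ioo 0 r, ∫⁻ y in Metric.closedBall x (5 * r), μ (Metric.ball y t) *
          ENNReal.ofReal (r ^ (β / 2) * t ^ (-d - β / 2 - 1)) :=
        lintegral_lintegral_swap (μ := volume.restrict (Metric.closedBall x (5 * r)))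
          (ν := volume.restrict (Ioo 0 r)) (f := fun y t => μ (Metric.ball y t) *
            ENNReal.ofReal (r ^ (β / 2) * t ^ (-d - β / 2 - 1))) hm2.aemeasurable
    _ ≤ ∫⁻ t in Ioo 0 r, m * v * ENNReal.ofReal (r ^ (β / 2)) *
          ENNReal.ofReal (t ^ (β / 2 - 1)) :=
        setLIntegral_mono' measurableSet_Ioo hpt
    _ = _ := by
        have h3 : 2 / β * r ^ β = r ^ (β / 2) * (r ^ (β / 2 - 1 + 1) / (β / 2 - 1 + 1)) := by
          have : r ^ β = r ^ (β / 2) * r ^ (β / 2) := by rw [← Real.rpow_add hr, add_halves]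
          rw [this, sub_add_cancel]
          field_simp
        rw [lintegral_const_mul _ (by fun_prop),
          lintegral_Ioo_zero_rpow (by linarith [half_pos hβ]) hr.le, h3,
          ENNReal.ofReal_mul (p := r ^ (β / 2)) (by positivity)]
        ring

/-- A weak-type bound at a single scale: near a point `y₀` where the balls of radius comparable to
`r` have controlled measure, the local potential exceeds a fixed level only on a small proportion
of the ball. -/
theorem volume_localPotential_gt_le {β : ℝ} (hβ : 0 < β) {r : ℝ} (hr : 0 < r)
    (μ : Measure (EuclideanSpace ℝ (Fin N))) [SFinite μ] (x y₀ : EuclideanSpace ℝ (Fin N))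
    (hy₀ : dist y₀ x ≤ 5 * r)
    (hμ : μ (Metric.ball y₀ (12 * r)) ≤ ENNReal.ofReal ((12 * r) ^ ((N : ℝ) - β))) :
    volume {y ∈ Metric.closedBall x (5 * r) |
      ENNReal.ofReal (6 * (12 ^ ((N : ℝ) - β) * (2 / β))) < localPotential β r μ y} ≤
      6⁻¹ * volume (Metric.closedBall x r) := by
  set d := (N : ℝ) - β with hd
  set A : ℝ := 12 ^ d * (2 / β) with hA_def
  have hA : 0 < A := by positivity
  set B := Metric.closedBall x (5 * r)
  have hmeas := localPotential_measurable β r μ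
  have hball : μ (Metric.ball x (6 * r)) ≤ ENNReal.ofReal ((12 * r) ^ d) := by
    refine (measure_mono (Metric.ball_subset_ball' ?_)).trans hμ
    rw [dist_comm]; linarith
  have hint : ∫⁻ y in B, localPotential β r μ y ≤
      ENNReal.ofReal A * volume (Metric.closedBall x r) := by
    refine (setLIntegral_localPotential_le hβ hr μ x).trans ?_
    rw [Measure.addHaar_closedBall volume x hr.le, finrank_euclideanSpace_fin, ← mul_assoc]
    refine mul_le_mul_left ((mul_le_mul_left hball _).trans (le_of_eq ?_)) _
    have h1 : r ^ N = r ^ d * r ^ β := by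
      rw [← Real.rpow_natCast, ← Real.rpow_add hr, hd, sub_add_cancel]
    rw [← ENNReal.ofReal_mul (by positivity), ← ENNReal.ofReal_mul hA.le, h1,
      Real.mul_rpow (by norm_num) hr.le, hA_def]
    congr 1
    ring
  have hmarkov := mul_meas_ge_le_lintegral (μ := volume.restrict B) hmeas (ENNReal.ofReal (6 * A))
  have hsub : volume {y ∈ B | ENNReal.ofReal (6 * A) < localPotential β r μ y} ≤
      (volume.restrict B) {y | ENNReal.ofReal (6 * A) ≤ localPotential β r μ y} := by
    rw [Measure.restrict_apply (measurableSet_le measurable_const hmeas)]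
    exact measure_mono fun y hy => ⟨hy.2.le, hy.1⟩
  have hA0 : ENNReal.ofReal A ≠ 0 := by simpa using hA
  have h3 : ENNReal.ofReal A * (6 * (volume.restrict B)
      {y | ENNReal.ofReal (6 * A) ≤ localPotential β r μ y}) ≤
      ENNReal.ofReal A * volume (Metric.closedBall x r) := by
    refine le_trans (le_of_eq ?_) (hmarkov.trans hint)
    rw [mul_comm 6 A, ENNReal.ofReal_mul hA.le, ENNReal.ofReal_ofNat, mul_assoc]
  have h4 := (ENNReal.mul_le_mul_iff_right hA0 ENNReal.ofReal_ne_top).1 h3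
  refine hsub.trans ?_
  rw [mul_comm 6⁻¹, ← div_eq_mul_inv, ENNReal.le_div_iff_mul_le (by simp) (by simp)]
  rwa [mul_comm] at h4

end LocalEstimate

/-! ### The Wolff potential at large scales -/

section FarEstimate

variable {N : ℕ}

/-- Bernoulli's inequality as a bound for the effect of a shift on a negative power. -/
theorem rpow_neg_le_add_rpow_neg {t c m : ℝ} (ht : 0 < t) (hc : 0 ≤ c) (hm : 1 ≤ m) :
    t ^ (-m) ≤ (t + c) ^ (-m) + m * c * t ^ (-m - 1) := by
  have htc : 0 < t + c := by linarith
  have h1 : 1 + m * (-(c / (t + c))) ≤ (1 + -(c / (t + c))) ^ m :=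
    one_add_mul_self_le_rpow_one_add (by
      rw [neg_le_neg_iff, div_le_one htc]; linarith) hm
  have h2 : 1 + -(c / (t + c)) = t / (t + c) := by field_simp; ring
  rw [h2, Real.div_rpow ht.le htc.le] at h1
  have h3 : c / (t + c) ≤ c / t := by gcongr; linarith
  have h4 : 1 - m * (c / t) ≤ t ^ m / (t + c) ^ m := by nlinarith
  have h5 : t ^ (-m) * (1 - m * (c / t)) ≤ t ^ (-m) * (t ^ m / (t + c) ^ m) := by gcongr
  have h6 : t ^ (-m) * (t ^ m / (t + c) ^ m) = (t + c) ^ (-m) := by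
    rw [Real.rpow_neg ht.le, Real.rpow_neg htc.le]; field_simp
  have h7 : t ^ (-m - 1) = t ^ (-m) / t := by rw [Real.rpow_sub ht, Real.rpow_one]
  rw [h6] at h5
  rw [h7]
  have h8 : t ^ (-m) * (1 - m * (c / t)) = t ^ (-m) - m * c * (t ^ (-m) / t) := by ring
  linarith

/-- The part of the Wolff potential at scales above `r` is almost constant at distance `16 r`: it
exceeds the whole potential at the other point by at most an absolute constant, once the measure of
the balls around one of the points is controlled. That the coefficient of the potential on the
right is exactly `1` is what makes the iteration of the rearrangement inequality possible. -/
theorem exists_far_le_truncWolff_add (N : ℕ) {β θ : ℝ} (hβ : β < N) (hθ : 0 < θ) :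
    ∃ C : ℝ≥0, ∀ (μ : Measure (EuclideanSpace ℝ (Fin N))) (r R : ℝ)
      (y z : EuclideanSpace ℝ (Fin N)), 0 < r → r < R → dist y z ≤ 16 * r →
      (∀ t, 0 < t → t < 64 * R → μ (Metric.ball y t) ≤ ENNReal.ofReal (t ^ ((N : ℝ) - β))) →
      ∫⁻ t in Ico r R, μ (Metric.ball y t) ^ θ *
          ENNReal.ofReal (t ^ (-(((N : ℝ) - β) * θ) - 1)) ≤
        truncWolff β θ (ENNReal.ofReal R) μ z + C := by
  set d := (N : ℝ) - β with hd_def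
  have hd : 0 < d := sub_pos.2 hβ
  set κ := d * θ with hκ_def
  have hκ : 0 < κ := by positivity
  set C₁ : ℝ := 33 ^ κ * ((κ + 1) * 16) with hC₁
  set C₂ : ℝ := 16 * 17 ^ κ with hC₂
  have hC₁0 : 0 < C₁ := by positivity
  have hC₂0 : 0 < C₂ := by positivity
  refine ⟨(C₂ + C₁).toNNReal, fun μ r R y z hr hrR hyz hy => ?_⟩
  have hR : 0 < R := hr.trans hrR
  change _ ≤ _ + ENNReal.ofReal (C₂ + C₁)
  have hball : ∀ u, 0 < u → u + 16 * r < 64 * R →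
      μ (Metric.ball z u) ^ θ ≤ ENNReal.ofReal ((u + 16 * r) ^ κ) := fun u hu huR => by
    have h1 : μ (Metric.ball z u) ≤ ENNReal.ofReal ((u + 16 * r) ^ d) :=
      (measure_mono (Metric.ball_subset_ball' (by rw [dist_comm]; linarith))).trans
        (hy (u + 16 * r) (by positivity) huR)
    refine (ENNReal.rpow_le_rpow h1 hθ.le).trans (le_of_eq ?_)
    rw [ENNReal.ofReal_rpow_of_nonneg (by positivity) hθ.le, ← Real.rpow_mul (by positivity)]
  set φ : ℝ → ℝ≥0∞ := fun u => μ (Metric.ball z u) ^ θ * ENNReal.ofReal (u ^ (-κ - 1)) with hφ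
  -- Pointwise comparison of the integrand at `y` with the shifted integrand at `z`.
  have hpt : ∀ t ∈ Ico r R, μ (Metric.ball y t) ^ θ * ENNReal.ofReal (t ^ (-κ - 1)) ≤
      φ (t + 16 * r) + ENNReal.ofReal (C₁ * r) * ENNReal.ofReal (t ^ (-2 : ℝ)) := by
    intro t ht
    have ht0 : 0 < t := hr.trans_le ht.1
    have h1 : μ (Metric.ball y t) ≤ μ (Metric.ball z (t + 16 * r)) :=
      measure_mono (Metric.ball_subset_ball' (by linarith))
    have h2 := rpow_neg_le_add_rpow_neg (c := 16 * r) (m := κ + 1) ht0 (by positivity)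
      (by linarith)
    have h3 : μ (Metric.ball z (t + 16 * r)) ^ θ ≤ ENNReal.ofReal ((33 * t) ^ κ) := by
      refine (hball (t + 16 * r) (by positivity) (by linarith [ht.2])).trans ?_
      apply ENNReal.ofReal_le_ofReal
      apply Real.rpow_le_rpow (by positivity) _ hκ.le
      linarith [ht.1]
    have e1 : -κ - 1 = -(κ + 1) := by ring
    calc _ ≤ μ (Metric.ball z (t + 16 * r)) ^ θ * ENNReal.ofReal ((t + 16 * r) ^ (-(κ + 1)) +
          (κ + 1) * (16 * r) * t ^ (-(κ + 1) - 1)) := by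
          rw [e1]
          exact mul_le_mul' (ENNReal.rpow_le_rpow h1 hθ.le) (ENNReal.ofReal_le_ofReal h2)
      _ = φ (t + 16 * r) + μ (Metric.ball z (t + 16 * r)) ^ θ *
          ENNReal.ofReal ((κ + 1) * (16 * r) * t ^ (-(κ + 1) - 1)) := by
          rw [ENNReal.ofReal_add (by positivity) (by positivity), mul_add, hφ, e1]
      _ ≤ φ (t + 16 * r) + ENNReal.ofReal ((33 * t) ^ κ) *
          ENNReal.ofReal ((κ + 1) * (16 * r) * t ^ (-(κ + 1) - 1)) := by gcongr
      _ = _ := by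
          rw [← ENNReal.ofReal_mul (by positivity), ← ENNReal.ofReal_mul (by positivity)]
          congr 2
          have e2 : (-2 : ℝ) = κ + (-(κ + 1) - 1) := by ring
          rw [e2, Real.rpow_add ht0, Real.mul_rpow (by norm_num) ht0.le, hC₁]
          ring
  have hshift : ∫⁻ t in Ico r R, φ (t + 16 * r) ≤ ∫⁻ u in Ioo 0 (R + 16 * r), φ u := by
    have h := (measurePreserving_add_right volume (16 * r)).setLIntegral_comp_preimage_emb
      (measurableEmbedding_addRight (16 * r)) φ (Ioo 0 (R + 16 * r))
    rw [← h]
    refine lintegral_mono_set fun t ht => ?_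
    exact ⟨by linarith [ht.1], by linarith [ht.2]⟩
  have htail : ∫⁻ u in Ico R (R + 16 * r), φ u ≤ ENNReal.ofReal C₂ := by
    calc ∫⁻ u in Ico R (R + 16 * r), φ u
        ≤ ∫⁻ _ in Ico R (R + 16 * r), ENNReal.ofReal (17 ^ κ * R⁻¹) := by
          refine setLIntegral_mono' measurableSet_Ico fun u hu => ?_
          have hu0 : 0 < u := hR.trans_le hu.1
          calc φ u ≤ ENNReal.ofReal ((u + 16 * r) ^ κ) * ENNReal.ofReal (u ^ (-κ - 1)) := by
                simp only [hφ]
                gcongr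
                exact hball u hu0 (by linarith [hu.2])
            _ ≤ ENNReal.ofReal ((17 * u) ^ κ * u ^ (-κ - 1)) := by
                rw [← ENNReal.ofReal_mul (by positivity)]
                apply ENNReal.ofReal_le_ofReal
                gcongr
                linarith [hu.1]
            _ = ENNReal.ofReal (17 ^ κ * u⁻¹) := by
                rw [Real.mul_rpow (by norm_num) hu0.le, mul_assoc, ← Real.rpow_add hu0,
                  ← Real.rpow_neg_one]
                congr 3; ring
            _ ≤ _ := by
                apply ENNReal.ofReal_le_ofReal
                gcongr
                exact hu.1
      _ = ENNReal.ofReal (17 ^ κ * R⁻¹ * (16 * r)) := by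
          rw [setLIntegral_const, Real.volume_Ico, add_sub_cancel_left,
            ← ENNReal.ofReal_mul (by positivity)]
      _ ≤ _ := by
          apply ENNReal.ofReal_le_ofReal
          have : R⁻¹ * r ≤ 1 := by rw [inv_mul_le_iff₀ hR]; linarith
          rw [hC₂]
          have h17 : (0 : ℝ) < 17 ^ κ := by positivity
          nlinarith
  have hsplit : ∫⁻ u in Ioo 0 (R + 16 * r), φ u ≤
      truncWolff β θ (ENNReal.ofReal R) μ z + ENNReal.ofReal C₂ := by
    rw [truncWolff_ofReal hθ.le]
    have hsub : Ioo 0 (R + 16 * r) ⊆ Ioo 0 R ∪ Ico R (R + 16 * r) := fun u hu => by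
      rcases lt_or_ge u R with h | h
      · exact Or.inl ⟨hu.1, h⟩
      · exact Or.inr ⟨h, hu.2⟩
    exact (lintegral_mono_set hsub).trans ((lintegral_union_le _ _ _).trans
      (add_le_add le_rfl htail))
  have hrest : ∫⁻ t in Ico r R, ENNReal.ofReal (C₁ * r) * ENNReal.ofReal (t ^ (-2 : ℝ)) ≤
      ENNReal.ofReal C₁ := by
    rw [lintegral_const_mul _ (by fun_prop)]
    have h1 : ∫⁻ t in Ico r R, ENNReal.ofReal (t ^ (-2 : ℝ)) ≤ ENNReal.ofReal (r⁻¹) := by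
      rw [setLIntegral_congr Ioo_ae_eq_Ico.symm]
      refine (lintegral_mono_set (Ioo_subset_Ioi_self)).trans ?_
      rw [lintegral_Ioi_rpow (by norm_num) hr]
      apply le_of_eq
      congr 1
      norm_num
      exact Real.rpow_neg_one r
    refine (mul_le_mul_right h1 _).trans (le_of_eq ?_)
    rw [← ENNReal.ofReal_mul (by positivity)]
    congr 1
    field_simp
  calc _ ≤ ∫⁻ t in Ico r R, (φ (t + 16 * r) +
        ENNReal.ofReal (C₁ * r) * ENNReal.ofReal (t ^ (-2 : ℝ))) :=
        setLIntegral_mono' measurableSet_Ico hpt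
    _ = (∫⁻ t in Ico r R, φ (t + 16 * r)) +
        ∫⁻ t in Ico r R, ENNReal.ofReal (C₁ * r) * ENNReal.ofReal (t ^ (-2 : ℝ)) :=
        lintegral_add_right _ (by fun_prop)
    _ ≤ (truncWolff β θ (ENNReal.ofReal R) μ z + ENNReal.ofReal C₂) + ENNReal.ofReal C₁ :=
        add_le_add (hshift.trans hsplit) hrest
    _ = _ := by rw [ENNReal.ofReal_add hC₂0.le hC₁0.le, add_assoc]

end FarEstimate

/-! ### The good-`λ` inequality -/

section GoodLambda

variable {N : ℕ}

theorem measure_ball_le_of_fracMaximal_le_one {β : ℝ} {R : ℝ≥0∞}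
    {μ : Measure (EuclideanSpace ℝ (Fin N))} {y : EuclideanSpace ℝ (Fin N)}
    (hy : fracMaximal β R μ y ≤ 1) {t : ℝ} (ht : 0 < t) (htR : ENNReal.ofReal t < R) :
    μ (Metric.ball y t) ≤ ENNReal.ofReal (t ^ ((N : ℝ) - β)) := by
  have h := (measure_div_rpow_le_fracMaximal β R μ y ht htR).trans hy
  have hpos : 0 < t ^ ((N : ℝ) - β) := Real.rpow_pos_of_pos ht _
  rwa [ENNReal.div_le_iff (by simpa using hpos) ENNReal.ofReal_ne_top, one_mul] at h

theorem truncWolff_le_add_setLIntegral_Ico {β θ : ℝ} (hθ : 0 ≤ θ) (r R : ℝ)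
    (μ : Measure (EuclideanSpace ℝ (Fin N))) (y : EuclideanSpace ℝ (Fin N)) :
    truncWolff β θ (ENNReal.ofReal R) μ y ≤ truncWolff β θ (ENNReal.ofReal r) μ y +
      ∫⁻ t in Ico r R, μ (Metric.ball y t) ^ θ *
        ENNReal.ofReal (t ^ (-(((N : ℝ) - β) * θ) - 1)) := by
  rw [truncWolff_ofReal hθ, truncWolff_ofReal hθ]
  refine (lintegral_mono_set fun t ht => ?_).trans (lintegral_union_le _ (Ioo 0 r) (Ico r R))
  rcases lt_or_ge t r with h | h
  · exact Or.inl ⟨ht.1, h⟩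
  · exact Or.inr ⟨h, ht.2⟩

/-- The good-`λ` inequality, normalised to level `1` of the maximal function: a Vitali covering of
`{W > l}` by balls on which the far part of `W` is at most `l + C` reduces it to the weak-type
bound at a single scale. -/
theorem exists_volume_truncWolff_gt_le {β θ : ℝ} (hβ0 : 0 < β) (hβ : β < N) (hθ : 0 < θ) :
    ∃ C : ℝ≥0, ∀ (μ : Measure (EuclideanSpace ℝ (Fin N))) [SFinite μ] (R t : ℝ) (l : ℝ≥0∞),
      0 < R → 0 < t →
      volume {x | l < truncWolff β θ (ENNReal.ofReal R) μ x} ≤ ENNReal.ofReal (2 * t) →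
      volume {x | 1 < fracMaximal β (ENNReal.ofReal (64 * R)) μ x} ≤ ENNReal.ofReal (t / 2) →
      volume {x | l + C < truncWolff β θ (ENNReal.ofReal R) μ x} ≤ ENNReal.ofReal t := by
  obtain ⟨Cf, hCf⟩ := exists_far_le_truncWolff_add N hβ hθ
  set A : ℝ := 6 * (12 ^ ((N : ℝ) - β) * (2 / β)) with hA
  refine ⟨A.toNNReal + (2 / (β * θ)).toNNReal + Cf, fun μ _ R t l hR ht hE hF => ?_⟩
  set W := truncWolff β θ (ENNReal.ofReal R) μ with hW
  set F := {x | 1 < fracMaximal β (ENNReal.ofReal (64 * R)) μ x} with hF_def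
  set C : ℝ≥0∞ := ((A.toNNReal + (2 / (β * θ)).toNNReal + Cf : ℝ≥0) : ℝ≥0∞) with hC
  have hCeq : C = ENNReal.ofReal A + ENNReal.ofReal (2 / (β * θ)) + Cf := by
    rw [hC, ENNReal.coe_add, ENNReal.coe_add]; rfl
  have hN : 0 < N := by
    have : (0 : ℝ) < N := hβ0.trans hβ
    exact_mod_cast this
  have : Nonempty (Fin N) := ⟨⟨0, hN⟩⟩
  -- An open superset of `{W > l}` of almost the same measure spares the semicontinuity of `W`.
  obtain ⟨U, hEU, hUo, hU⟩ := Set.exists_isOpen_le_add {x | l < W x} volume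
    (ε := ENNReal.ofReal t) (by simpa using ht)
  have hU3 : volume U ≤ ENNReal.ofReal (3 * t) := by
    refine hU.trans ((add_le_add hE le_rfl).trans (le_of_eq ?_))
    rw [← ENNReal.ofReal_add (by positivity) ht.le]; congr 1; ring
  have hUc : (Uᶜ).Nonempty := by
    rw [nonempty_compl]
    rintro rfl
    rw [measure_univ_of_isAddLeftInvariant] at hU3
    exact ENNReal.ofReal_ne_top (top_le_iff.1 hU3)
  set G := {x | l + C < W x} \ F with hG
  have hGU : ∀ x ∈ G, x ∈ U := fun x hx =>
    hEU (show l < W x from lt_of_le_of_lt le_self_add (show l + C < W x from hx.1))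
  have hball : ∀ y ∈ G, ∀ τ, 0 < τ → τ < 64 * R →
      μ (Metric.ball y τ) ≤ ENNReal.ofReal (τ ^ ((N : ℝ) - β)) := fun y hy τ hτ hτR =>
    measure_ball_le_of_fracMaximal_le_one (not_lt.1 hy.2) hτ
      ((ENNReal.ofReal_lt_ofReal_iff_of_nonneg hτ.le).2 hτR)
  -- The radius is capped at `R`, so that only a bounded enlargement of `R` enters the maximal
  -- function; a ball with radius `R` sees no scales above its own.
  set ρ : EuclideanSpace ℝ (Fin N) → ℝ := fun x => min R (Metric.infDist x Uᶜ / 10) with hρ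
  have hinf : ∀ x ∈ U, 0 < Metric.infDist x Uᶜ := fun x hx =>
    (hUo.isClosed_compl.notMem_iff_infDist_pos hUc).1 (not_not_intro hx)
  have hρ0 : ∀ x ∈ U, 0 < ρ x := fun x hx => lt_min hR (by linarith [hinf x hx])
  obtain ⟨u, huG, hdisj, hcov⟩ := Vitali.exists_disjoint_subfamily_covering_enlargement_closedBall
    G id ρ R (fun x _ => min_le_left _ _) 5 (by norm_num)
  have hucount : u.Countable := hdisj.countable_of_nonempty_interior fun b hb =>
    ⟨b, Metric.ball_subset_interior_closedBall (Metric.mem_ball_self (hρ0 b (hGU b (huG hb))))⟩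
  -- On each selected ball the good set is small.
  have hloc : ∀ b ∈ u, volume (G ∩ Metric.closedBall b (5 * ρ b)) ≤
      6⁻¹ * volume (Metric.closedBall b (ρ b)) := by
    intro b hb
    have hr := hρ0 b (hGU b (huG hb))
    have hrR : ρ b ≤ R := min_le_left _ _
    rcases (G ∩ Metric.closedBall b (5 * ρ b)).eq_empty_or_nonempty with hemp | ⟨y₀, hy₀G, hy₀⟩
    · rw [hemp]; simp
    refine le_trans (measure_mono fun y hy => ?_) (volume_localPotential_gt_le hβ0 hr μ b y₀ hy₀
      (hball y₀ hy₀G _ (by positivity) (by linarith)))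
    refine ⟨hy.2, ?_⟩
    by_contra hcon
    have hcon : localPotential β (ρ b) μ y ≤ ENNReal.ofReal A := not_lt.1 hcon
    have hyB := hball y hy.1
    have h1 : truncWolff β θ (ENNReal.ofReal (ρ b)) μ y ≤
        ENNReal.ofReal A + ENNReal.ofReal (2 / (β * θ)) :=
      (truncWolff_le_localPotential hβ0 hθ hr fun τ hτ hτr =>
        hyB τ hτ (by linarith)).trans (add_le_add hcon le_rfl)
    have h2 : W y ≤ l + C := by
      rcases hrR.lt_or_eq with hlt | heq
      · have hdist : Metric.infDist b Uᶜ < 11 * ρ b := by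
          have : ρ b = Metric.infDist b Uᶜ / 10 := by
            rcases min_choice R (Metric.infDist b Uᶜ / 10) with h | h
            · exact absurd h hlt.ne
            · exact h
          linarith
        obtain ⟨z, hzU, hz⟩ := (Metric.infDist_lt_iff hUc).1 hdist
        have hWz : W z ≤ l := not_lt.1 fun h => hzU (hEU h)
        have hyz : dist y z ≤ 16 * ρ b := by
          have := dist_triangle y b z
          have hyb : dist y b ≤ 5 * ρ b := hy.2
          linarith
        calc W y ≤ _ := truncWolff_le_add_setLIntegral_Ico hθ.le (ρ b) R μ y
          _ ≤ (ENNReal.ofReal A + ENNReal.ofReal (2 / (β * θ))) + (W z + Cf) :=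
              add_le_add h1 (hCf μ (ρ b) R y z hr hlt hyz hyB)
          _ ≤ (ENNReal.ofReal A + ENNReal.ofReal (2 / (β * θ))) + (l + Cf) := by gcongr
          _ = l + C := by rw [hCeq]; ring
      · rw [heq] at h1
        refine h1.trans ?_
        rw [hCeq]
        exact le_add_left le_self_add
    exact absurd hy.1.1 (not_lt.2 h2)
  have hGle : volume G ≤ ENNReal.ofReal (t / 2) := by
    calc volume G ≤ volume (⋃ b ∈ u, G ∩ Metric.closedBall b (5 * ρ b)) := by
          refine measure_mono fun x hx => ?_
          obtain ⟨b, hb, hxb⟩ := hcov x hx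
          refine mem_iUnion₂.2 ⟨b, hb, hx, hxb ?_⟩
          exact Metric.mem_closedBall_self (hρ0 x (hGU x hx)).le
      _ ≤ ∑' b : u, volume (G ∩ Metric.closedBall (b : EuclideanSpace ℝ (Fin N)) (5 * ρ b)) :=
          measure_biUnion_le volume hucount _
      _ ≤ ∑' b : u, 6⁻¹ * volume (Metric.closedBall (b : EuclideanSpace ℝ (Fin N)) (ρ b)) :=
          ENNReal.tsum_le_tsum fun b => hloc b b.2
      _ = 6⁻¹ * volume (⋃ b ∈ u, Metric.closedBall b (ρ b)) := by
          have h := measure_biUnion (μ := volume) hucount hdisj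
            fun b _ => Metric.isClosed_closedBall.measurableSet
          simp only [id] at h
          rw [ENNReal.tsum_mul_left, h]
      _ ≤ 6⁻¹ * ENNReal.ofReal (3 * t) := by
          refine mul_le_mul_right ((measure_mono ?_).trans hU3) _
          refine iUnion₂_subset fun b hb x hx => ?_
          by_contra hxU
          have hbU := hGU b (huG hb)
          have h1 : Metric.infDist b Uᶜ ≤ dist b x := Metric.infDist_le_dist_of_mem hxU
          have h2 : dist x b ≤ ρ b := hx
          have h3 : ρ b ≤ Metric.infDist b Uᶜ / 10 := min_le_right _ _
          rw [dist_comm] at h1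
          linarith [hinf b hbU]
      _ = ENNReal.ofReal (t / 2) := by
          rw [← ENNReal.ofReal_ofNat, ← ENNReal.ofReal_inv_of_pos (by norm_num),
            ← ENNReal.ofReal_mul (by positivity)]
          congr 1; ring
  calc volume {x | l + C < W x} ≤ volume (G ∪ F) := measure_mono fun x hx => by
        by_cases hxF : x ∈ F
        · exact Or.inr hxF
        · exact Or.inl ⟨hx, hxF⟩
    _ ≤ volume G + volume F := measure_union_le _ _
    _ ≤ ENNReal.ofReal (t / 2) + ENNReal.ofReal (t / 2) := add_le_add hGle hF
    _ = ENNReal.ofReal t := by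
        rw [← ENNReal.ofReal_add (by positivity) (by positivity), add_halves]

end GoodLambda

/-! ### The rearrangement inequality -/

section RearrangementInequality

variable {N : ℕ}

theorem fracMaximal_smul (β : ℝ) (R : ℝ≥0∞) (c : ℝ≥0∞) (μ : Measure (EuclideanSpace ℝ (Fin N)))
    (x : EuclideanSpace ℝ (Fin N)) :
    fracMaximal β R (c • μ) x = c * fracMaximal β R μ x := by
  simp only [fracMaximal, Measure.smul_apply, smul_eq_mul, ENNReal.mul_iSup, mul_div_assoc]

theorem truncWolff_smul (β : ℝ) {θ : ℝ} (hθ : 0 ≤ θ) (R : ℝ≥0∞) {c : ℝ≥0∞} (hc : c ≠ ∞)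
    (μ : Measure (EuclideanSpace ℝ (Fin N))) (x : EuclideanSpace ℝ (Fin N)) :
    truncWolff β θ R (c • μ) x = c ^ θ * truncWolff β θ R μ x := by
  simp only [truncWolff, Measure.smul_apply, smul_eq_mul, mul_div_assoc,
    ENNReal.mul_rpow_of_nonneg _ _ hθ]
  rw [lintegral_const_mul' _ _ (ENNReal.rpow_ne_top_of_nonneg hθ hc)]

theorem fracMaximal_mono (β : ℝ) {R R' : ℝ≥0∞} (hR : R ≤ R')
    {μ μ' : Measure (EuclideanSpace ℝ (Fin N))} (hμ : μ ≤ μ') (x : EuclideanSpace ℝ (Fin N)) :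
    fracMaximal β R μ x ≤ fracMaximal β R' μ' x :=
  iSup_le fun _ => iSup_le fun ht => iSup_le fun htR =>
    (ENNReal.div_le_div_right (hμ _) _).trans
      (measure_div_rpow_le_fracMaximal β R' μ' x ht (htR.trans_le hR))

/-- One step of the rearrangement form of the good-`λ` inequality. -/
theorem exists_decrRearr_truncWolff_le_add {β θ : ℝ} (hβ0 : 0 < β) (hβ : β < N) (hθ : 0 < θ) :
    ∃ C : ℝ≥0, ∀ (μ : Measure (EuclideanSpace ℝ (Fin N))) [SFinite μ] (R t : ℝ),
      0 < R → 0 < t →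
      decrRearr volume (truncWolff β θ (ENNReal.ofReal R) μ) t ≤
        decrRearr volume (truncWolff β θ (ENNReal.ofReal R) μ) (2 * t) +
          C * decrRearr volume (fracMaximal β (ENNReal.ofReal (64 * R)) μ) (t / 2) ^ θ := by
  obtain ⟨C, hC⟩ := exists_volume_truncWolff_gt_le hβ0 hβ hθ
  refine ⟨C + 1, fun μ _ R t hR ht => ?_⟩
  set W := truncWolff β θ (ENNReal.ofReal R) μ with hW
  set M := fracMaximal β (ENNReal.ofReal (64 * R)) μ with hM
  set l := decrRearr volume W (2 * t) with hl
  set A := decrRearr volume M (t / 2) with hA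
  -- The constant `C + 1` is nonzero, so the right-hand side is infinite when `A = ∞`.
  rcases eq_or_ne A ∞ with hAt | hAt
  · rw [hAt, ENNReal.top_rpow_of_pos hθ, ENNReal.mul_top (by simp)]
    simp
  -- Normalise the level `a` of the maximal function to `1` by scaling the measure.
  have hstep : ∀ a : ℝ≥0∞, A < a → a ≠ ∞ → decrRearr volume W t ≤ l + C * a ^ θ := by
    intro a haA hat
    have ha0 : a ≠ 0 := (zero_le.trans_lt haA).ne'
    have hai0 : a⁻¹ ^ θ ≠ 0 := by
      simp [hat, ha0]
    have hait : a⁻¹ ^ θ ≠ ∞ := ENNReal.rpow_ne_top_of_nonneg hθ.le (ENNReal.inv_ne_top.2 ha0)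
    have h := hC (a⁻¹ • μ) R t (a⁻¹ ^ θ * l) hR ht
    simp only [truncWolff_smul β hθ.le _ (ENNReal.inv_ne_top.2 ha0), fracMaximal_smul] at h
    apply decrRearr_le_of_distribFun_le
    refine le_trans (measure_mono fun x hx => ?_) (h ?_ ?_)
    · have hx' : l + C * a ^ θ < W x := hx
      have h2 : a⁻¹ ^ θ * (l + C * a ^ θ) < a⁻¹ ^ θ * W x :=
        (ENNReal.mul_lt_mul_iff_right hai0 hait).2 hx'
      have h3 : a⁻¹ ^ θ * (l + C * a ^ θ) = a⁻¹ ^ θ * l + C := by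
        rw [mul_add, mul_left_comm, ← ENNReal.mul_rpow_of_nonneg _ _ hθ.le,
          ENNReal.inv_mul_cancel ha0 hat, ENNReal.one_rpow, mul_one]
      rw [h3] at h2
      exact h2
    · refine le_trans (measure_mono fun x hx => ?_) (distribFun_decrRearr_le W (2 * t))
      have hx' : a⁻¹ ^ θ * l < a⁻¹ ^ θ * W x := hx
      exact (ENNReal.mul_lt_mul_iff_right hai0 hait).1 hx'
    · refine le_trans (measure_mono fun x hx => ?_) (distribFun_decrRearr_le M (t / 2))
      have hx' : 1 < a⁻¹ * M x := hx
      have h2 : a * 1 < a * (a⁻¹ * M x) := (ENNReal.mul_lt_mul_iff_right ha0 hat).2 hx'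
      rw [mul_one, ← mul_assoc, ENNReal.mul_inv_cancel ha0 hat, one_mul] at h2
      exact haA.trans h2
  have hlim : decrRearr volume W t ≤ l + C * A ^ θ := by
    have hcont : Continuous fun a : ℝ≥0∞ => l + C * a ^ θ :=
      continuous_const.add ((ENNReal.continuous_const_mul ENNReal.coe_ne_top).comp
        (ENNReal.continuous_rpow_const))
    have : (nhdsWithin A (Ioi A)).NeBot := nhdsGT_neBot_of_exists_gt ⟨∞, hAt.lt_top⟩
    refine ge_of_tendsto (hcont.continuousWithinAt (s := Ioi A)) ?_
    filter_upwards [self_mem_nhdsWithin, mem_nhdsWithin_of_mem_nhds (Iio_mem_nhds hAt.lt_top)]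
      with a ha ha'
    exact hstep a ha (ne_of_lt ha')
  refine hlim.trans ?_
  gcongr
  simp

/-- For a measure supported in a ball, the truncated Wolff potential vanishes outside a larger ball,
so its rearrangement vanishes for large `t`. -/
theorem decrRearr_truncWolff_restrict_eq_zero {β θ : ℝ} (hθ : 0 < θ) {R ρ : ℝ}
    (μ : Measure (EuclideanSpace ℝ (Fin N))) {t : ℝ}
    (ht : volume (Metric.ball (0 : EuclideanSpace ℝ (Fin N)) (ρ + R)) ≤ ENNReal.ofReal t) :
    decrRearr volume
      (truncWolff β θ (ENNReal.ofReal R) (μ.restrict (Metric.ball 0 ρ))) t = 0 := by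
  rw [← nonpos_iff_eq_zero]
  apply decrRearr_le_of_distribFun_le
  refine (measure_mono fun x hx => ?_).trans ht
  by_contra hxb
  refine (lt_irrefl (0 : ℝ≥0∞)) (lt_of_lt_of_eq hx ?_)
  rw [truncWolff_ofReal hθ.le]
  rw [setLIntegral_congr_fun (g := fun _ => 0) measurableSet_Ioo, lintegral_zero]
  intro t ht
  have : Metric.ball x t ∩ Metric.ball 0 ρ = ∅ := by
    ext y
    simp only [mem_inter_iff, Metric.mem_ball, mem_empty_iff_false, iff_false, not_and, not_lt]
      at hxb ⊢
    intro hy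
    have := dist_triangle x y 0
    rw [dist_comm x y] at this
    linarith [ht.2]
  simp [Measure.restrict_apply Metric.isOpen_ball.measurableSet, this, hθ]

theorem truncWolff_eq_iSup_restrict {β θ : ℝ} (hθ : 0 < θ) (R : ℝ)
    (μ : Measure (EuclideanSpace ℝ (Fin N))) (x : EuclideanSpace ℝ (Fin N)) :
    truncWolff β θ (ENNReal.ofReal R) μ x =
      ⨆ j : ℕ, truncWolff β θ (ENNReal.ofReal R) (μ.restrict (Metric.ball 0 j)) x := by
  simp only [truncWolff_ofReal hθ.le]
  have hmono : Monotone fun (j : ℕ) => Metric.ball (0 : EuclideanSpace ℝ (Fin N)) j :=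
    fun i j hij => Metric.ball_subset_ball (by exact_mod_cast hij)
  rw [← lintegral_iSup]
  · refine lintegral_congr fun t => ?_
    rw [← ENNReal.iSup_mul]
    congr 1
    have h1 : μ (Metric.ball x t) = ⨆ j : ℕ, (μ.restrict (Metric.ball 0 j)) (Metric.ball x t) := by
      simp only [Measure.restrict_apply Metric.isOpen_ball.measurableSet]
      rw [← Monotone.measure_iUnion
        (fun i j hij => inter_subset_inter_right _ (hmono hij)), ← inter_iUnion,
        Metric.iUnion_ball_nat, inter_univ]
    rw [h1]
    exact (ENNReal.orderIsoRpow θ hθ).map_iSup _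
  · intro j
    have : Measurable fun t => (μ.restrict (Metric.ball 0 j)) (Metric.ball x t) :=
      Monotone.measurable fun s t hst => measure_mono (Metric.ball_subset_ball hst)
    fun_prop
  · intro i j hij t
    exact mul_le_mul_left (ENNReal.rpow_le_rpow
      (Measure.restrict_mono (hmono hij) le_rfl _) hθ.le) _

theorem truncWolff_restrict_mono {β θ : ℝ} (hθ : 0 ≤ θ) (R : ℝ≥0∞)
    (μ : Measure (EuclideanSpace ℝ (Fin N))) :
    Monotone fun j : ℕ => truncWolff β θ R (μ.restrict (Metric.ball 0 j)) := fun i j hij x => by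
  refine lintegral_mono fun t => ENNReal.div_le_div_right (ENNReal.rpow_le_rpow
    (ENNReal.div_le_div_right (Measure.restrict_mono
      (Metric.ball_subset_ball (by exact_mod_cast hij)) le_rfl _) _) hθ) _

theorem truncWolff_mono_radius (β θ : ℝ) {R R' : ℝ≥0∞} (hR : R ≤ R')
    (μ : Measure (EuclideanSpace ℝ (Fin N))) (x : EuclideanSpace ℝ (Fin N)) :
    truncWolff β θ R μ x ≤ truncWolff β θ R' μ x :=
  lintegral_mono_set fun _ ht => ⟨ht.1, ht.2.trans_le hR⟩

theorem truncWolff_top_eq_iSup (β θ : ℝ)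
    (μ : Measure (EuclideanSpace ℝ (Fin N))) (x : EuclideanSpace ℝ (Fin N)) :
    truncWolff β θ ∞ μ x = ⨆ j : ℕ, truncWolff β θ (ENNReal.ofReal ((j : ℝ) + 1)) μ x := by
  unfold truncWolff
  rw [← setLIntegral_iUnion_of_directed]
  · congr 2
    ext t
    simp only [mem_ofPred_eq, ENNReal.ofReal_lt_top, and_true, mem_iUnion]
    constructor
    · intro ht
      obtain ⟨j, hj⟩ := exists_nat_gt t
      exact ⟨j, ht, (ENNReal.ofReal_lt_ofReal_iff_of_nonneg ht.le).2 (by linarith)⟩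
    · rintro ⟨j, ht, -⟩
      exact ht
  · refine Monotone.directed_le fun i j hij t ht => ⟨ht.1, ht.2.trans_le ?_⟩
    have : (i : ℝ) ≤ j := by exact_mod_cast hij
    exact ENNReal.ofReal_le_ofReal (by linarith)

/-- The rearrangement of the Wolff potential is dominated by a dyadic Hardy-type average of the
rearrangement of the maximal function, uniformly in the truncation radius. -/
theorem exists_decrRearr_truncWolff_le_tsum {β θ : ℝ} (hβ0 : 0 < β) (hβ : β < N) (hθ : 0 < θ) :
    ∃ (C : ℝ≥0) (c : ℝ), 0 < c ∧ ∀ (μ : Measure (EuclideanSpace ℝ (Fin N))) [SFinite μ]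
      (R : ℝ≥0∞) (t : ℝ), 0 < R → 0 < t →
      decrRearr volume (truncWolff β θ R μ) t ≤
        ∑' k : ℕ, C * decrRearr volume (fracMaximal β R μ) (c * 2 ^ k * t) ^ θ := by
  obtain ⟨C, hC⟩ := exists_decrRearr_truncWolff_le_add hβ0 hβ hθ
  obtain ⟨m, hm, hM, -⟩ := exists_decrRearr_doubling N
  have hm0 : (0 : ℝ) < m := by exact_mod_cast hm
  have hiter : ∀ (μ : Measure (EuclideanSpace ℝ (Fin N))) [SFinite μ] (R t : ℝ), 0 < R → 0 < t →
      ∀ n : ℕ, decrRearr volume (truncWolff β θ (ENNReal.ofReal R) μ) t ≤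
        decrRearr volume (truncWolff β θ (ENNReal.ofReal R) μ) (2 ^ n * t) +
          ∑ k ∈ Finset.range n, C * decrRearr volume
            (fracMaximal β (ENNReal.ofReal (64 * R)) μ) (2 ^ k * t / 2) ^ θ := by
    intro μ _ R t hR ht n
    induction n with
    | zero => simp
    | succ n ih =>
      refine ih.trans ?_
      rw [Finset.sum_range_succ, add_comm (Finset.sum _ _), ← add_assoc, pow_succ', mul_assoc]
      exact add_le_add (hC μ R (2 ^ n * t) hR (by positivity)) le_rfl
  -- For finite radii, exhaust the measure by compactly supported ones, for which the remainder
  -- vanishes after finitely many steps.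
  have hcpt : ∀ (μ : Measure (EuclideanSpace ℝ (Fin N))) [SFinite μ] (R t : ℝ), 0 < R → 0 < t →
      decrRearr volume (truncWolff β θ (ENNReal.ofReal R) μ) t ≤
        ∑' k : ℕ, C * decrRearr volume
          (fracMaximal β (ENNReal.ofReal (64 * R)) μ) (2 ^ k * t / 2) ^ θ := by
    intro μ _ R t hR ht
    have hsup : truncWolff β θ (ENNReal.ofReal R) μ = fun x => ⨆ j : ℕ,
        truncWolff β θ (ENNReal.ofReal R) (μ.restrict (Metric.ball 0 j)) x :=
      funext fun x => truncWolff_eq_iSup_restrict hθ R μ x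
    rw [hsup]
    refine (decrRearr_iSup_le (truncWolff_restrict_mono hθ.le _ μ) t).trans (iSup_le fun j => ?_)
    obtain ⟨n, hn⟩ : ∃ n : ℕ,
        (volume (Metric.ball (0 : EuclideanSpace ℝ (Fin N)) (j + R))).toReal / t < 2 ^ n :=
      pow_unbounded_of_one_lt _ (by norm_num)
    rw [div_lt_iff₀ ht] at hn
    have hzero := decrRearr_truncWolff_restrict_eq_zero (β := β) hθ (R := R) (ρ := j) μ
      (t := 2 ^ n * t) (by
        rw [← ENNReal.ofReal_toReal (measure_ball_lt_top (μ := volume)).ne]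
        exact ENNReal.ofReal_le_ofReal hn.le)
    refine (hiter (μ.restrict (Metric.ball 0 j)) R t hR ht n).trans ?_
    rw [hzero, zero_add]
    refine (Finset.sum_le_sum fun k _ => ?_).trans (ENNReal.sum_le_tsum (Finset.range n))
    refine mul_le_mul_right (ENNReal.rpow_le_rpow (decrRearr_mono (fun x => ?_) _) hθ.le) _
    exact fracMaximal_mono β le_rfl Measure.restrict_le_self x
  -- Six doublings bring the radius `64 R` back to `R`.
  refine ⟨C * ((m : ℝ≥0) ^ 6) ^ θ, ((m : ℝ) ^ 6)⁻¹ / 2, by positivity, fun μ _ R t hR ht => ?_⟩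
  have hreal : ∀ (R' : ℝ), 0 < R' → ENNReal.ofReal R' ≤ R →
      decrRearr volume (truncWolff β θ (ENNReal.ofReal R') μ) t ≤
        ∑' k : ℕ, ((C * ((m : ℝ≥0) ^ 6) ^ θ : ℝ≥0) : ℝ≥0∞) *
          decrRearr volume (fracMaximal β R μ) (((m : ℝ) ^ 6)⁻¹ / 2 * 2 ^ k * t) ^ θ := by
    intro R' hR' hRR
    refine (hcpt μ R' t hR' ht).trans (ENNReal.tsum_le_tsum fun k => ?_)
    have h1 := decrRearr_fracMaximal_two_pow_le (β := β) (R := ENNReal.ofReal R') (μ := μ)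
      (fun R t ht => hM β hβ.le R μ t ht) 6 (t := ((m : ℝ) ^ 6)⁻¹ / 2 * 2 ^ k * t) (by positivity)
    have h2 : (2 : ℝ≥0∞) ^ 6 * ENNReal.ofReal R' = ENNReal.ofReal (64 * R') := by
      rw [ENNReal.ofReal_mul (by norm_num), ENNReal.ofReal_ofNat]; norm_num
    have h3 : (m : ℝ) ^ 6 * (((m : ℝ) ^ 6)⁻¹ / 2 * 2 ^ k * t) = 2 ^ k * t / 2 := by
      field_simp
    rw [h2, h3] at h1
    rw [ENNReal.coe_mul, mul_assoc, ENNReal.coe_rpow_of_nonneg _ hθ.le, ENNReal.coe_pow,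
      ENNReal.coe_natCast, ← ENNReal.mul_rpow_of_nonneg _ _ hθ.le]
    refine mul_le_mul_right (ENNReal.rpow_le_rpow (h1.trans (mul_le_mul_right ?_ _)) hθ.le) _
    exact decrRearr_mono (fun x => fracMaximal_mono β hRR le_rfl x) _
  rcases eq_or_ne R ∞ with rfl | hRt
  · have hsup : truncWolff β θ ∞ μ = fun x => ⨆ j : ℕ,
        truncWolff β θ (ENNReal.ofReal ((j : ℝ) + 1)) μ x :=
      funext fun x => truncWolff_top_eq_iSup β θ μ x
    rw [hsup]
    refine (decrRearr_iSup_le (fun i j hij x => ?_) t).trans (iSup_le fun j => ?_)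
    · have : (i : ℝ) ≤ j := by exact_mod_cast hij
      exact truncWolff_mono_radius β θ (ENNReal.ofReal_le_ofReal (by linarith)) μ x
    · exact hreal _ (by positivity) le_top
  · have h := hreal R.toReal (ENNReal.toReal_pos hR.ne' hRt) (ENNReal.ofReal_toReal hRt).le
    rwa [ENNReal.ofReal_toReal hRt] at h

end RearrangementInequality

/-! ### Bounds for the Bessel kernel -/

section BesselKernel

variable {N : ℕ}

/-- The subordination integral `∫_0^∞ t^{-a-1} e^{-t} e^{-r²/(4t)} dt`, a multiple of the Bessel
kernel of order `N - 2 a` at distance `r`. -/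
noncomputable def subordInt (a r : ℝ) : ℝ≥0∞ :=
  ∫⁻ t in Ioi (0 : ℝ), ENNReal.ofReal (t ^ (-a - 1) * Real.exp (-t) * Real.exp (-r ^ 2 / (4 * t)))

theorem besselKernel_eq {β : ℝ} (hβ : 0 < β) (x : EuclideanSpace ℝ (Fin N)) :
    besselKernel β x =
      ENNReal.ofReal ((4 * Real.pi) ^ (-(N : ℝ) / 2) / Real.Gamma (β / 2)) *
        subordInt (((N : ℝ) - β) / 2) ‖x‖ := by
  have hG : 0 < Real.Gamma (β / 2) := Real.Gamma_pos_of_pos (by positivity)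
  have h4 : (0 : ℝ) < (4 * Real.pi) ^ (-(N : ℝ) / 2) := by positivity
  have key : ∫⁻ t in Ioi (0 : ℝ), ENNReal.ofReal (t ^ (β / 2 - 1) * Real.exp (-t) *
      (4 * Real.pi * t) ^ (-(N : ℝ) / 2) * Real.exp (-‖x‖ ^ 2 / (4 * t))) =
      ENNReal.ofReal ((4 * Real.pi) ^ (-(N : ℝ) / 2)) *
        subordInt (((N : ℝ) - β) / 2) ‖x‖ := by
    unfold subordInt
    rw [← lintegral_const_mul _ (by fun_prop)]
    refine setLIntegral_congr_fun measurableSet_Ioi fun t ht => ?_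
    have ht0 : (0 : ℝ) < t := ht
    rw [← ENNReal.ofReal_mul h4.le]
    congr 1
    have h1 : t ^ (-(((N : ℝ) - β) / 2) - 1) = t ^ (β / 2 - 1) * t ^ (-(N : ℝ) / 2) := by
      rw [← Real.rpow_add ht0]; congr 1; ring
    rw [h1, Real.mul_rpow (by positivity) ht0.le]
    ring
  unfold besselKernel
  rw [key, ENNReal.ofReal_div_of_pos hG, ENNReal.div_eq_inv_mul, ENNReal.div_eq_inv_mul, mul_assoc]

theorem exp_neg_le_rpow {x j : ℝ} (hx : 0 < x) (hj : 0 < j) : Real.exp (-x) ≤ (j / x) ^ j := by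
  have h1 : x / j ≤ Real.exp (x / j) := by linarith [Real.add_one_le_exp (x / j)]
  have h2 : (x / j) ^ j ≤ Real.exp x := by
    calc (x / j) ^ j ≤ Real.exp (x / j) ^ j := Real.rpow_le_rpow (by positivity) h1 hj.le
      _ = Real.exp x := by rw [← Real.exp_mul, div_mul_cancel₀ _ hj.ne']
  rw [Real.exp_neg, ← inv_div, Real.inv_rpow (by positivity)]
  exact inv_anti₀ (by positivity) h2

theorem gaussian_le_rpow {r t j : ℝ} (hr : 0 < r) (ht : 0 < t) (hj : 0 < j) :
    Real.exp (-r ^ 2 / (4 * t)) ≤ (4 * j) ^ j * r ^ (-(2 * j)) * t ^ j := by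
  have h := exp_neg_le_rpow (x := r ^ 2 / (4 * t)) (by positivity) hj
  rw [neg_div]
  refine h.trans (le_of_eq ?_)
  have h1 : j / (r ^ 2 / (4 * t)) = 4 * j * (r ^ (2 : ℝ))⁻¹ * t := by
    rw [Real.rpow_two]; field_simp
  rw [h1, Real.mul_rpow (by positivity) ht.le, Real.mul_rpow (by positivity) (by positivity),
    ← Real.rpow_neg hr.le, ← Real.rpow_mul hr.le]
  congr 3; ring

/-- The size of the kernel near the origin. -/
theorem exists_subordInt_le_rpow {a : ℝ} (ha : 0 < a) :
    ∃ C : ℝ, 0 ≤ C ∧ ∀ r, 0 < r → subordInt a r ≤ ENNReal.ofReal (C * r ^ (-(2 * a))) := by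
  set D : ℝ := (4 * (a + 1)) ^ (a + 1)
  have hD : 0 < D := by positivity
  refine ⟨D + 1 / a, by positivity, fun r hr => ?_⟩
  have hr2 : 0 < r ^ 2 := by positivity
  have hsub : Ioi (0 : ℝ) ⊆ Ioc 0 (r ^ 2) ∪ Ioi (r ^ 2) := fun t ht => by
    rcases le_or_gt t (r ^ 2) with h | h
    · exact Or.inl ⟨ht, h⟩
    · exact Or.inr h
  have h1 : ∫⁻ t in Ioc 0 (r ^ 2), ENNReal.ofReal
      (t ^ (-a - 1) * Real.exp (-t) * Real.exp (-r ^ 2 / (4 * t))) ≤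
      ENNReal.ofReal (D * r ^ (-(2 * a))) := by
    calc _ ≤ ∫⁻ _ in Ioc 0 (r ^ 2), ENNReal.ofReal (D * r ^ (-(2 * (a + 1)))) := by
          refine setLIntegral_mono' measurableSet_Ioc fun t ht => ENNReal.ofReal_le_ofReal ?_
          have ht0 := ht.1
          have e1 : Real.exp (-t) ≤ 1 := Real.exp_le_one_iff.2 (by linarith)
          have e2 := gaussian_le_rpow hr ht0 (j := a + 1) (by positivity)
          calc t ^ (-a - 1) * Real.exp (-t) * Real.exp (-r ^ 2 / (4 * t))
              ≤ t ^ (-a - 1) * 1 * (D * r ^ (-(2 * (a + 1))) * t ^ (a + 1)) := by gcongr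
            _ = D * r ^ (-(2 * (a + 1))) * (t ^ (-a - 1) * t ^ (a + 1)) := by ring
            _ = _ := by
                rw [← Real.rpow_add ht0]
                have : -a - 1 + (a + 1) = 0 := by ring
                rw [this, Real.rpow_zero, mul_one]
      _ = _ := by
          rw [setLIntegral_const, Real.volume_Ioc, sub_zero, ← ENNReal.ofReal_mul (by positivity),
            mul_assoc, ← Real.rpow_two, ← Real.rpow_add hr]
          congr 3; ring
  have h2 : ∫⁻ t in Ioi (r ^ 2), ENNReal.ofReal
      (t ^ (-a - 1) * Real.exp (-t) * Real.exp (-r ^ 2 / (4 * t))) ≤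
      ENNReal.ofReal (1 / a * r ^ (-(2 * a))) := by
    calc _ ≤ ∫⁻ t in Ioi (r ^ 2), ENNReal.ofReal (t ^ (-a - 1)) := by
          refine setLIntegral_mono' measurableSet_Ioi fun t ht => ENNReal.ofReal_le_ofReal ?_
          have ht0 : 0 < t := hr2.trans ht
          have e1 : Real.exp (-t) ≤ 1 := Real.exp_le_one_iff.2 (by linarith)
          have e2 : Real.exp (-r ^ 2 / (4 * t)) ≤ 1 := Real.exp_le_one_iff.2 (by
            rw [neg_div]; exact neg_nonpos.2 (by positivity))
          calc _ ≤ t ^ (-a - 1) * 1 * 1 := by gcongr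
            _ = _ := by ring
      _ = _ := by
          rw [lintegral_Ioi_rpow (by linarith) hr2]
          congr 1
          rw [sub_add_cancel, ← Real.rpow_two, ← Real.rpow_mul hr.le, mul_neg]
          field_simp
  calc subordInt a r ≤ _ := (lintegral_mono_set hsub).trans (lintegral_union_le _ _ _)
    _ ≤ _ := add_le_add h1 h2
    _ = _ := by rw [← ENNReal.ofReal_add (by positivity) (by positivity), add_mul]

/-- Arbitrarily fast polynomial decay of the kernel at infinity. -/
theorem exists_subordInt_le_rpow_of_lt {a j : ℝ} (ha : 0 < a) (hj : a < j) :
    ∃ C : ℝ, 0 ≤ C ∧ ∀ r, 0 < r → subordInt a r ≤ ENNReal.ofReal (C * r ^ (-(2 * j))) := by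
  have hj0 : 0 < j := ha.trans hj
  have hG : 0 < Real.Gamma (j - a) := Real.Gamma_pos_of_pos (sub_pos.2 hj)
  refine ⟨(4 * j) ^ j * Real.Gamma (j - a), by positivity, fun r hr => ?_⟩
  have hΓ : ∫⁻ t in Ioi (0 : ℝ), ENNReal.ofReal (Real.exp (-t) * t ^ (j - a - 1)) =
      ENNReal.ofReal (Real.Gamma (j - a)) := by
    rw [Real.Gamma_eq_integral (sub_pos.2 hj),
      ofReal_integral_eq_lintegral_ofReal (Real.GammaIntegral_convergent (sub_pos.2 hj))]
    filter_upwards [ae_restrict_mem measurableSet_Ioi] with t ht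
    have ht0 : (0 : ℝ) < t := ht
    positivity
  calc subordInt a r ≤ ∫⁻ t in Ioi (0 : ℝ), ENNReal.ofReal ((4 * j) ^ j * r ^ (-(2 * j))) *
        ENNReal.ofReal (Real.exp (-t) * t ^ (j - a - 1)) := by
        refine setLIntegral_mono' measurableSet_Ioi fun t ht => ?_
        have ht0 : (0 : ℝ) < t := ht
        rw [← ENNReal.ofReal_mul (by positivity)]
        apply ENNReal.ofReal_le_ofReal
        have e2 := gaussian_le_rpow hr ht0 hj0
        have e3 : t ^ (j - a - 1) = t ^ (-a - 1) * t ^ j := by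
          rw [← Real.rpow_add ht0]; congr 1; ring
        calc _ ≤ t ^ (-a - 1) * Real.exp (-t) * ((4 * j) ^ j * r ^ (-(2 * j)) * t ^ j) := by
              gcongr
          _ = _ := by rw [e3]; ring
    _ = _ := by
        rw [lintegral_const_mul _ (by fun_prop), hΓ, ← ENNReal.ofReal_mul (by positivity)]
        congr 1; ring

/-- The lower bound for the kernel comes from the times between `t ^ 2` and `2 t ^ 2`. -/
theorem rpow_le_subordInt {a R r t : ℝ} (hr : 0 ≤ r) (hrt : r < t) (htR : t < R) (ha : 0 < a) :
    ENNReal.ofReal (2 ^ (-a - 1) * Real.exp (-(2 * R ^ 2)) * Real.exp (-(1 / 4)) * t ^ (-(2 * a))) ≤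
      subordInt a r := by
  have ht : 0 < t := hr.trans_lt hrt
  have ht2 : 0 < t ^ 2 := by positivity
  calc _ = ∫⁻ _ in Ioo (t ^ 2) (2 * t ^ 2), ENNReal.ofReal
        ((2 * t ^ 2) ^ (-a - 1) * Real.exp (-(2 * R ^ 2)) * Real.exp (-(1 / 4))) := by
        rw [setLIntegral_const, Real.volume_Ioo, ← ENNReal.ofReal_mul (by positivity)]
        congr 1
        have h1 : (t ^ 2) ^ (-a - 1) * t ^ 2 = t ^ (-(2 * a)) := by
          rw [← Real.rpow_two, ← Real.rpow_mul ht.le, ← Real.rpow_add ht]; congr 1; ring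
        rw [Real.mul_rpow (by norm_num) ht2.le, ← h1]
        ring
    _ ≤ ∫⁻ u in Ioo (t ^ 2) (2 * t ^ 2), ENNReal.ofReal
        (u ^ (-a - 1) * Real.exp (-u) * Real.exp (-r ^ 2 / (4 * u))) := by
        refine setLIntegral_mono' measurableSet_Ioo fun u hu => ENNReal.ofReal_le_ofReal ?_
        have hu0 : 0 < u := ht2.trans hu.1
        have e1 : (2 * t ^ 2) ^ (-a - 1) ≤ u ^ (-a - 1) :=
          Real.rpow_le_rpow_of_nonpos hu0 hu.2.le (by linarith)
        have e2 : -(2 * R ^ 2) ≤ -u := by nlinarith [hu.2]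
        have e3 : -(1 / 4) ≤ -r ^ 2 / (4 * u) := by
          rw [neg_div, neg_le_neg_iff, div_le_div_iff₀ (by positivity) (by norm_num)]
          nlinarith [hu.1]
        gcongr
    _ ≤ _ := lintegral_mono_set fun u hu => ht2.trans hu.1

/-- The Bessel kernel is dominated by a truncated Riesz kernel, written as a superposition of
indicators of balls, and a rapidly decreasing combination of indicators of dyadic balls. -/
theorem exists_besselKernel_le {β : ℝ} (hβ0 : 0 < β) (hβ : β < N) {ρ : ℝ} (hρ : 0 < ρ) {m : ℕ}
    (hm : (N : ℝ) - β < m) :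
    ∃ C B : ℝ≥0, ∀ x : EuclideanSpace ℝ (Fin N), besselKernel β x ≤
      C * (∫⁻ t in Ioo 0 ρ, (Ioi ‖x‖).indicator
        (fun t => ENNReal.ofReal (t ^ (-((N : ℝ) - β) - 1))) t) +
      ∑' k : ℕ, (B : ℝ≥0∞) * ENNReal.ofReal (((2 : ℝ) ^ m)⁻¹ ^ k) *
        (Iio (2 ^ k * ρ)).indicator (fun _ => 1) ‖x‖ := by
  set d := (N : ℝ) - β with hd_def
  have hd : 0 < d := sub_pos.2 hβ
  obtain ⟨C₁, hC₁, h1⟩ := exists_subordInt_le_rpow (a := d / 2) (by positivity)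
  obtain ⟨C₂, hC₂, h2⟩ := exists_subordInt_le_rpow_of_lt (a := d / 2) (j := (m : ℝ) / 2)
    (by positivity) (by linarith)
  have e1 : 2 * (d / 2) = d := by ring
  have e2 : 2 * ((m : ℝ) / 2) = m := by ring
  rw [e1] at h1
  rw [e2] at h2
  have hG : 0 < Real.Gamma (β / 2) := Real.Gamma_pos_of_pos (by positivity)
  set A : ℝ := (4 * Real.pi) ^ (-(N : ℝ) / 2) / Real.Gamma (β / 2) with hA_def
  have hA : 0 < A := by positivity
  -- The summand `1` makes the constant positive even if `C₁ = 0`, as needed at `x = 0`, where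
  -- both sides are infinite.
  refine ⟨(A * C₁ * 2 ^ (d + 1) + 1).toNNReal, (A * C₂ * (ρ / 2) ^ (-(m : ℝ))).toNNReal,
    fun x => ?_⟩
  set r := ‖x‖ with hr_def
  have hr0 : 0 ≤ r := norm_nonneg x
  set J := ∫⁻ t in Ioo 0 ρ, (Ioi r).indicator (fun t => ENNReal.ofReal (t ^ (-d - 1))) t with hJ
  rw [besselKernel_eq hβ0, ← hd_def, ← hA_def, ← hr_def]
  rcases lt_or_ge r (ρ / 2) with hrρ | hrρ
  · refine le_add_right ?_
    have hJle : ∀ τ, 0 < τ → r ≤ τ → τ ≤ ρ / 2 →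
        ENNReal.ofReal (τ ^ (-d)) ≤ ENNReal.ofReal (2 ^ (d + 1)) * J := by
      intro τ hτ hrτ hτρ
      have h3 : ENNReal.ofReal ((2 * τ) ^ (-d - 1) * τ) ≤ J := by
        calc _ = ∫⁻ _ in Ioo τ (2 * τ), ENNReal.ofReal ((2 * τ) ^ (-d - 1)) := by
              rw [setLIntegral_const, Real.volume_Ioo, ← ENNReal.ofReal_mul (by positivity)]
              congr 2; ring
          _ ≤ ∫⁻ t in Ioo τ (2 * τ), (Ioi r).indicator
                (fun t => ENNReal.ofReal (t ^ (-d - 1))) t := by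
              refine setLIntegral_mono' measurableSet_Ioo fun t ht => ?_
              rw [indicator_of_mem (show t ∈ Ioi r from hrτ.trans_lt ht.1)]
              exact ENNReal.ofReal_le_ofReal (Real.rpow_le_rpow_of_nonpos (hτ.trans ht.1) ht.2.le
                (by linarith))
          _ ≤ J := lintegral_mono_set fun t ht => ⟨hτ.trans ht.1, by linarith [ht.2]⟩
      refine le_trans (le_of_eq ?_) (mul_le_mul_right h3 _)
      rw [← ENNReal.ofReal_mul (by positivity)]
      congr 1
      rw [Real.mul_rpow (by norm_num) hτ.le, Real.rpow_sub hτ, Real.rpow_one]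
      have : (2 : ℝ) ^ (-d - 1) = (2 ^ (d + 1))⁻¹ := by
        rw [← Real.rpow_neg (by norm_num)]; congr 1; ring
      rw [this]
      field_simp
    rcases hr0.eq_or_lt with hr | hr
    · have hJtop : J = ∞ := by
        by_contra hne
        have hfin : ENNReal.ofReal (2 ^ (d + 1)) * J ≠ ∞ :=
          ENNReal.mul_ne_top ENNReal.ofReal_ne_top hne
        have hlim : Filter.Tendsto (fun τ : ℝ => τ ^ (-d)) (nhdsWithin 0 (Ioi 0)) Filter.atTop :=
          tendsto_rpow_neg_nhdsGT_zero (by linarith)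
        have hev := hlim.eventually (Filter.eventually_gt_atTop
          (ENNReal.ofReal (2 ^ (d + 1)) * J).toReal)
        have hev2 : ∀ᶠ τ : ℝ in nhdsWithin 0 (Ioi 0), τ ∈ Ioo 0 (ρ / 2) :=
          Ioo_mem_nhdsGT (by positivity)
        obtain ⟨τ, hτ1, hτ2⟩ := (hev.and hev2).exists
        have := hJle τ hτ2.1 (by rw [← hr]; exact hτ2.1.le) hτ2.2.le
        rw [ENNReal.ofReal_le_iff_le_toReal hfin] at this
        linarith
      rw [hJtop, ENNReal.mul_top]
      · exact le_top
      · simp only [ne_eq, ENNReal.coe_eq_zero, Real.toNNReal_eq_zero, not_le]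
        positivity
    · change _ ≤ ENNReal.ofReal (A * C₁ * 2 ^ (d + 1) + 1) * J
      calc ENNReal.ofReal A * subordInt (d / 2) r
          ≤ ENNReal.ofReal A * ENNReal.ofReal (C₁ * r ^ (-d)) := mul_le_mul_right (h1 r hr) _
        _ = ENNReal.ofReal (A * C₁) * ENNReal.ofReal (r ^ (-d)) := by
            rw [← ENNReal.ofReal_mul hA.le, ← ENNReal.ofReal_mul (by positivity), mul_assoc]
        _ ≤ ENNReal.ofReal (A * C₁) * (ENNReal.ofReal (2 ^ (d + 1)) * J) :=
            mul_le_mul_right (hJle r hr le_rfl hrρ.le) _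
        _ ≤ _ := by
            rw [← mul_assoc, ← ENNReal.ofReal_mul (by positivity)]
            exact mul_le_mul_left (ENNReal.ofReal_le_ofReal (by linarith)) _
  · refine le_add_left ?_
    have hr : 0 < r := (half_pos hρ).trans_le hrρ
    obtain ⟨n, hn1, hn2⟩ := exists_nat_pow_near (x := r / (ρ / 2)) (y := 2)
      ((one_le_div (half_pos hρ)).2 hrρ) (by norm_num)
    rw [le_div_iff₀ (half_pos hρ)] at hn1
    rw [div_lt_iff₀ (half_pos hρ)] at hn2
    have hrn : r < 2 ^ n * ρ := by
      rw [pow_succ] at hn2; linarith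
    refine le_trans ?_ (ENNReal.le_tsum n)
    rw [indicator_of_mem (show r ∈ Iio (2 ^ n * ρ) from hrn), mul_one]
    change _ ≤ ENNReal.ofReal (A * C₂ * (ρ / 2) ^ (-(m : ℝ))) * _
    rw [← ENNReal.ofReal_mul (by positivity)]
    calc ENNReal.ofReal A * subordInt (d / 2) r
        ≤ ENNReal.ofReal A * ENNReal.ofReal (C₂ * r ^ (-(m : ℝ))) := mul_le_mul_right (h2 r hr) _
      _ = ENNReal.ofReal (A * (C₂ * r ^ (-(m : ℝ)))) := by rw [← ENNReal.ofReal_mul hA.le]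
      _ ≤ _ := by
          apply ENNReal.ofReal_le_ofReal
          have h4 : r ^ (-(m : ℝ)) ≤ (2 ^ n * (ρ / 2)) ^ (-(m : ℝ)) :=
            Real.rpow_le_rpow_of_nonpos (by positivity) hn1 (by simp)
          have h5 : ((2 : ℝ) ^ n * (ρ / 2)) ^ (-(m : ℝ)) =
              ((2 : ℝ) ^ m)⁻¹ ^ n * (ρ / 2) ^ (-(m : ℝ)) := by
            rw [Real.mul_rpow (by positivity) (by positivity)]
            congr 1
            rw [Real.rpow_neg (by positivity), Real.rpow_natCast, inv_pow, ← pow_mul, ← pow_mul,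
              mul_comm]
          rw [h5] at h4
          calc A * (C₂ * r ^ (-(m : ℝ)))
              ≤ A * (C₂ * (((2 : ℝ) ^ m)⁻¹ ^ n * (ρ / 2) ^ (-(m : ℝ)))) := by
                gcongr
            _ = _ := by ring

end BesselKernel

/-! ### Pointwise bounds for the Bessel potential -/

section BesselPotential

variable {N : ℕ}

/-- By Tonelli's theorem, superposing indicators of balls yields the Wolff potential with `θ = 1`. -/
theorem lintegral_truncated_riesz_eq {β : ℝ} (ρ : ℝ) (μ : Measure (EuclideanSpace ℝ (Fin N)))
    [SFinite μ] (x : EuclideanSpace ℝ (Fin N)) :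
    ∫⁻ y, (∫⁻ t in Ioo 0 ρ, (Ioi ‖x - y‖).indicator
        (fun t => ENNReal.ofReal (t ^ (-((N : ℝ) - β) - 1))) t) ∂μ =
      truncWolff β 1 (ENNReal.ofReal ρ) μ x := by
  have hopen : IsOpen {w : EuclideanSpace ℝ (Fin N) × ℝ | ‖x - w.1‖ < w.2} :=
    isOpen_lt (by fun_prop) (by fun_prop)
  have hmeas : Measurable (Function.uncurry fun (y : EuclideanSpace ℝ (Fin N)) (t : ℝ) =>
      (Ioi ‖x - y‖).indicator (fun t => ENNReal.ofReal (t ^ (-((N : ℝ) - β) - 1))) t) :=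
    Measurable.indicator (f := fun w : EuclideanSpace ℝ (Fin N) × ℝ =>
      ENNReal.ofReal (w.2 ^ (-((N : ℝ) - β) - 1))) (by fun_prop) hopen.measurableSet
  rw [lintegral_lintegral_swap hmeas.aemeasurable, truncWolff_ofReal zero_le_one]
  refine lintegral_congr fun t => ?_
  have h1 : ∀ y, (Ioi ‖x - y‖).indicator
      (fun t => ENNReal.ofReal (t ^ (-((N : ℝ) - β) - 1))) t =
      (Metric.ball x t).indicator (fun _ => ENNReal.ofReal (t ^ (-((N : ℝ) - β) - 1))) y := by
    intro y
    simp only [indicator, mem_Ioi, Metric.mem_ball, dist_eq_norm, norm_sub_rev x y]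
  simp only [h1]
  rw [lintegral_indicator Metric.isOpen_ball.measurableSet, setLIntegral_const, mul_comm,
    ENNReal.rpow_one, mul_one]

theorem exists_besselPotentialMeas_le {β : ℝ} (hβ0 : 0 < β) (hβ : β < N) {ρ : ℝ} (hρ : 0 < ρ)
    {m : ℕ} (hm : (N : ℝ) - β < m) :
    ∃ C B : ℝ≥0, ∀ (μ : Measure (EuclideanSpace ℝ (Fin N))) [SFinite μ]
      (x : EuclideanSpace ℝ (Fin N)), besselPotentialMeas β μ x ≤
        C * truncWolff β 1 (ENNReal.ofReal ρ) μ x +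
        ∑' k : ℕ, (B : ℝ≥0∞) * ENNReal.ofReal (((2 : ℝ) ^ m)⁻¹ ^ k) *
          μ (Metric.ball x (2 ^ k * ρ)) := by
  obtain ⟨C, B, h⟩ := exists_besselKernel_le hβ0 hβ hρ hm
  refine ⟨C, B, fun μ _ x => ?_⟩
  have hind : ∀ (k : ℕ) (y : EuclideanSpace ℝ (Fin N)),
      (Iio (2 ^ k * ρ)).indicator (fun _ => (1 : ℝ≥0∞)) ‖x - y‖ =
        (Metric.ball x (2 ^ k * ρ)).indicator (fun _ => 1) y := by
    intro k y
    simp only [indicator, mem_Iio, Metric.mem_ball, dist_eq_norm, norm_sub_rev x y]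
  have hm1 : ∀ k : ℕ, Measurable fun y : EuclideanSpace ℝ (Fin N) =>
      (Metric.ball x (2 ^ k * ρ)).indicator (fun _ => (1 : ℝ≥0∞)) y := fun k =>
    measurable_const.indicator Metric.isOpen_ball.measurableSet
  have hm2 : ∀ k : ℕ, Measurable fun y : EuclideanSpace ℝ (Fin N) =>
      (B : ℝ≥0∞) * ENNReal.ofReal (((2 : ℝ) ^ m)⁻¹ ^ k) *
        (Metric.ball x (2 ^ k * ρ)).indicator (fun _ => 1) y := fun k => (hm1 k).const_mul _
  unfold besselPotentialMeas
  refine (lintegral_mono fun y => h (x - y)).trans (le_of_eq ?_)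
  simp only [hind]
  rw [lintegral_add_right _ (Measurable.tsum hm2),
    lintegral_const_mul' _ _ ENNReal.coe_ne_top, lintegral_truncated_riesz_eq, lintegral_tsum fun k => (hm2 k).aemeasurable]
  congr 1
  refine tsum_congr fun k => ?_
  rw [lintegral_const_mul _ (hm1 k), lintegral_indicator Metric.isOpen_ball.measurableSet,
    setLIntegral_const, one_mul]

theorem exists_fracMaximal_le_besselPotentialMeas {β : ℝ} (hβ0 : 0 < β) (hβ : β < N) (R : ℝ) :
    ∃ C : ℝ≥0, ∀ (μ : Measure (EuclideanSpace ℝ (Fin N))) (x : EuclideanSpace ℝ (Fin N)),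
      fracMaximal β (ENNReal.ofReal R) μ x ≤ C * besselPotentialMeas β μ x := by
  set d := (N : ℝ) - β with hd_def
  have hd : 0 < d := sub_pos.2 hβ
  have hG : 0 < Real.Gamma (β / 2) := Real.Gamma_pos_of_pos (by positivity)
  set A : ℝ := (4 * Real.pi) ^ (-(N : ℝ) / 2) / Real.Gamma (β / 2) with hA_def
  have hA : 0 < A := by positivity
  set B : ℝ := 2 ^ (-(d / 2) - 1) * Real.exp (-(2 * R ^ 2)) * Real.exp (-(1 / 4)) with hB_def
  have hB : 0 < B := by positivity
  refine ⟨((A * B)⁻¹).toNNReal, fun μ x => ?_⟩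
  refine iSup_le fun t => iSup_le fun ht => iSup_le fun htR => ?_
  have htR' : t < R := (ENNReal.ofReal_lt_ofReal_iff_of_nonneg ht.le).1 htR
  have hker : ∀ y ∈ Metric.ball x t, ENNReal.ofReal (A * (B * t ^ (-d))) ≤
      besselKernel β (x - y) := by
    intro y hy
    rw [besselKernel_eq hβ0, ← hd_def, ← hA_def, ENNReal.ofReal_mul hA.le]
    refine mul_le_mul_right ?_ _
    have h := rpow_le_subordInt (a := d / 2) (norm_nonneg (x - y))
      (by rw [← dist_eq_norm, dist_comm]; exact hy) htR' (by positivity)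
    have e1 : 2 * (d / 2) = d := by ring
    rwa [e1] at h
  have h1 : ENNReal.ofReal (A * (B * t ^ (-d))) * μ (Metric.ball x t) ≤
      besselPotentialMeas β μ x := by
    rw [← setLIntegral_const]
    exact (setLIntegral_mono' Metric.isOpen_ball.measurableSet hker).trans
      (setLIntegral_le_lintegral _ _)
  change _ ≤ ENNReal.ofReal ((A * B)⁻¹) * _
  refine le_trans (le_of_eq ?_) (mul_le_mul_right h1 _)
  rw [← mul_assoc, ← ENNReal.ofReal_mul (by positivity), div_eq_mul_inv,
    ← ENNReal.ofReal_inv_of_pos (by positivity), mul_comm]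
  congr 2
  rw [Real.rpow_neg ht.le, ← hd_def]
  field_simp

end BesselPotential

/-! ### Norm inequalities -/

section NormInequalities

variable {N : ℕ}

theorem exists_wNorm_truncWolff_le {β θ q : ℝ} {s : ℝ≥0∞} (hβ0 : 0 < β) (hβ : β < N)
    (hθ : 0 < θ) (hq : 0 < q) (hs : s ≠ 0) :
    ∃ K : ℝ≥0, ∀ (μ : Measure (EuclideanSpace ℝ (Fin N))) [SFinite μ] (R : ℝ≥0∞), 0 < R →
      wNorm q s (decrRearr volume (truncWolff β θ R μ)) ≤
        K * wNorm q s (fun t => decrRearr volume (fracMaximal β R μ) t ^ θ) := by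
  obtain ⟨C, c, hc, h⟩ := exists_decrRearr_truncWolff_le_tsum hβ0 hβ hθ
  obtain ⟨K, hK⟩ := wNorm_le_of_le_tsum_dilation (q := q) hs (a := fun _ => (C : ℝ))
    (b := fun k => c * 2 ^ k) (C := C * c ^ (-(1 / q))) (ρ := 2 ^ (-(1 / q)))
    (fun _ => C.2) (fun k => by positivity) (by positivity)
    (Real.rpow_lt_one_of_one_lt_of_neg (by norm_num) (neg_lt_zero.2 (by positivity)))
    (fun k => by
      rw [Real.mul_rpow hc.le (by positivity), ← mul_assoc, ← Real.rpow_natCast,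
        ← Real.rpow_natCast, ← Real.rpow_mul (by norm_num), ← Real.rpow_mul (by norm_num),
        mul_comm (k : ℝ)])
  refine ⟨K, fun μ _ R hR => hK _ _ ?_ fun t ht => ?_⟩
  · exact (decrRearr_measurable _).pow_const θ
  · simpa only [ENNReal.ofReal_coe_nnreal] using h μ R t hR ht

theorem exists_wNorm_fracMaximal_le {β θ q : ℝ} {s : ℝ≥0∞} (hβ : β ≤ N)
    (hθ : 0 < θ) (hs : s ≠ 0) :
    ∃ K : ℝ≥0, ∀ (μ : Measure (EuclideanSpace ℝ (Fin N))) (R : ℝ≥0∞),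
      wNorm q s (fun t => decrRearr volume (fracMaximal β R μ) t ^ θ) ≤
        K * wNorm q s (decrRearr volume (truncWolff β θ R μ)) := by
  obtain ⟨C, c, hc, h⟩ := exists_decrRearr_fracMaximal_le_truncWolff (N := N) hβ hθ
  obtain ⟨K, hK⟩ := wNorm_le_of_le_dilation (q := q) hs (a := C) (b := c) C.2 hc
  refine ⟨K, fun μ R => hK _ _ (decrRearr_measurable _) fun t ht => ?_⟩
  simpa only [ENNReal.ofReal_coe_nnreal] using h R μ t ht

theorem decrRearr_measure_ball_le_fracMaximal (β : ℝ) {R : ℝ} (hR : 0 < R)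
    (μ : Measure (EuclideanSpace ℝ (Fin N))) (t : ℝ) :
    decrRearr volume (fun x => μ (Metric.ball x (R / 2))) t ≤
      ENNReal.ofReal ((R / 2) ^ ((N : ℝ) - β)) *
        decrRearr volume (fracMaximal β (ENNReal.ofReal R) μ) t := by
  refine (decrRearr_mono (fun x => ?_) t).trans (decrRearr_const_mul_le _ _ t)
  have h := measure_div_rpow_le_fracMaximal β (ENNReal.ofReal R) μ x (t := R / 2) (by positivity)
    ((ENNReal.ofReal_lt_ofReal_iff hR).2 (by linarith))
  have hpos : 0 < (R / 2) ^ ((N : ℝ) - β) := by positivity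
  rwa [ENNReal.div_le_iff (by simpa using hpos) ENNReal.ofReal_ne_top, mul_comm] at h

/-- The Bessel potential is controlled by the truncated maximal function: its singular part is a
truncated Riesz potential, that is a Wolff potential with `θ = 1`, and its tail is a rapidly
decreasing combination of measures of dyadic balls. -/
theorem exists_wNorm_besselPotentialMeas_le {β q : ℝ} {s : ℝ≥0∞} (hβ0 : 0 < β) (hβ : β < N)
    (hq : 0 < q) (hs : s ≠ 0) {R : ℝ} (hR : 0 < R) :
    ∃ K : ℝ≥0, ∀ (μ : Measure (EuclideanSpace ℝ (Fin N))) [SFinite μ],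
      wNorm q s (decrRearr volume (besselPotentialMeas β μ)) ≤
        K * wNorm q s (decrRearr volume (fracMaximal β (ENNReal.ofReal R) μ)) := by
  obtain ⟨M, hM0, -, hM⟩ := exists_decrRearr_doubling N
  have hMr : (0 : ℝ) < M := by exact_mod_cast hM0
  -- The decay exponent `m` has to beat the loss from covering large balls by translates.
  obtain ⟨m₁, hm₁⟩ := pow_unbounded_of_one_lt ((M : ℝ) * (2 * M) ^ (1 / q)) (one_lt_two (α := ℝ))
  obtain ⟨m₂, hm₂⟩ := exists_nat_gt ((N : ℝ) - β)
  set m := max m₁ m₂ with hm_def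
  have hmd : (N : ℝ) - β < m := hm₂.trans_le (by exact_mod_cast le_max_right m₁ m₂)
  have hmM : (M : ℝ) * (2 * M) ^ (1 / q) < 2 ^ m :=
    hm₁.trans_le (pow_le_pow_right₀ (by norm_num) (le_max_left m₁ m₂))
  obtain ⟨C, B, hG⟩ := exists_besselPotentialMeas_le hβ0 hβ (half_pos hR) hmd
  set D : ℝ := (R / 2) ^ ((N : ℝ) - β) with hD_def
  have hD : 0 < D := by positivity
  -- The tail of the Bessel potential.
  set T : Measure (EuclideanSpace ℝ (Fin N)) → EuclideanSpace ℝ (Fin N) → ℝ≥0∞ := fun μ x =>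
    ∑' k : ℕ, (B : ℝ≥0∞) * ENNReal.ofReal (((2 : ℝ) ^ m)⁻¹ ^ k) *
      μ (Metric.ball x (2 ^ k * (R / 2))) with hT_def
  obtain ⟨K₁, hK₁⟩ := exists_wNorm_truncWolff_le (N := N) (θ := 1) hβ0 hβ one_pos hq hs
  obtain ⟨K₂, hK₂⟩ := wNorm_le_of_le_dilation (q := q) hs (a := C) (b := 1 / 2) C.2 (by norm_num)
  obtain ⟨K₃, hK₃⟩ := wNorm_le_of_le_tsum_dilation (q := q) hs
    (a := fun k => (B : ℝ) * ((2 : ℝ) ^ m)⁻¹ ^ k * ((M : ℝ) ^ k * D))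
    (b := fun k => ((M : ℝ) ^ k)⁻¹ * (((1 : ℝ) / 2) ^ k * (1 / 4)))
    (C := (B : ℝ) * D * 4 ^ (1 / q)) (ρ := ((2 : ℝ) ^ m)⁻¹ * ((M : ℝ) * (2 * (M : ℝ)) ^ (1 / q)))
    (fun k => by positivity) (fun k => by positivity) (by positivity)
    (by rw [inv_mul_lt_iff₀ (by positivity), mul_one]; exact hmM)
    (fun k => by
      have e1 : ((M : ℝ) ^ k)⁻¹ * ((1 / 2) ^ k * (1 / 4)) = ((2 * (M : ℝ)) ^ k * 4)⁻¹ := by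
        rw [mul_pow, one_div, inv_pow]; field_simp
      rw [e1, Real.rpow_neg (by positivity), Real.inv_rpow (by positivity), inv_inv,
        Real.mul_rpow (by positivity) (by norm_num), ← Real.rpow_pow_comm (by positivity)]
      apply le_of_eq
      ring)
  obtain ⟨K₄, hK₄⟩ := wNorm_add_le q s
  refine ⟨K₄ * (K₂ * K₁ + K₃), fun μ _ => ?_⟩
  set g := decrRearr volume (fracMaximal β (ENNReal.ofReal R) μ) with hg
  set w := decrRearr volume (truncWolff β 1 (ENNReal.ofReal R) μ) with hw
  have hsplit : ∀ t, 0 < t → decrRearr volume (besselPotentialMeas β μ) t ≤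
      C * w (1 / 2 * t) + decrRearr volume (T μ) (1 / 2 * t) := by
    intro t ht
    have e : t / 2 = 1 / 2 * t := by ring
    refine (decrRearr_mono (fun x => hG μ x) t).trans ?_
    refine (decrRearr_add_le _ _ ht.le).trans (add_le_add ?_ (by rw [e]))
    rw [e]
    refine (decrRearr_const_mul_le _ _ _).trans
      (mul_le_mul_right (decrRearr_mono (fun x => ?_) _) _)
    exact truncWolff_mono_radius β 1 (ENNReal.ofReal_le_ofReal (by linarith)) μ x
  have htail : ∀ t, 0 < t → decrRearr volume (T μ) (1 / 2 * t) ≤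
      ∑' k : ℕ, ENNReal.ofReal (B * ((2 : ℝ) ^ m)⁻¹ ^ k * (M ^ k * D)) *
        g (((M : ℝ) ^ k)⁻¹ * ((1 / 2) ^ k * (1 / 4)) * t) := by
    intro t ht
    have hτ : ∑' k : ℕ, ENNReal.ofReal ((1 / 2) ^ k * (1 / 4 * t)) ≤
        ENNReal.ofReal (1 / 2 * t) := by
      have hsum : HasSum (fun k : ℕ => (1 / 2 : ℝ) ^ k * (1 / 4 * t)) (2 * (1 / 4 * t)) :=
        hasSum_geometric_two.mul_right _
      rw [← ENNReal.ofReal_tsum_of_nonneg (fun k => by positivity) hsum.summable, hsum.tsum_eq]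
      apply le_of_eq; congr 1; ring
    refine (decrRearr_tsum_le _ _ hτ).trans (ENNReal.tsum_le_tsum fun k => ?_)
    refine (decrRearr_const_mul_le _ _ _).trans ?_
    have h1 := decrRearr_measure_ball_two_pow_le (μ := μ) (fun ρ t hρ => hM μ ρ t hρ)
      (half_pos hR) k (((M : ℝ) ^ k)⁻¹ * ((1 / 2) ^ k * (1 / 4)) * t)
    have e1 : (M : ℝ) ^ k * (((M : ℝ) ^ k)⁻¹ * ((1 / 2) ^ k * (1 / 4)) * t) =
        (1 / 2) ^ k * (1 / 4 * t) := by field_simp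
    rw [e1] at h1
    have h2 := decrRearr_measure_ball_le_fracMaximal β hR μ
      (((M : ℝ) ^ k)⁻¹ * ((1 / 2) ^ k * (1 / 4)) * t)
    calc _ ≤ (B : ℝ≥0∞) * ENNReal.ofReal (((2 : ℝ) ^ m)⁻¹ ^ k) * ((M : ℝ≥0∞) ^ k *
          (ENNReal.ofReal D * g (((M : ℝ) ^ k)⁻¹ * ((1 / 2) ^ k * (1 / 4)) * t))) :=
          mul_le_mul_right (h1.trans (mul_le_mul_right h2 _)) _
      _ = _ := by
          rw [ENNReal.ofReal_mul (p := B * ((2 : ℝ) ^ m)⁻¹ ^ k) (by positivity),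
            ENNReal.ofReal_mul (p := (B : ℝ)) (by positivity),
            ENNReal.ofReal_mul (p := (M : ℝ) ^ k) (by positivity),
            ENNReal.ofReal_pow (p := (M : ℝ)) (by positivity), ENNReal.ofReal_natCast,
            ENNReal.ofReal_coe_nnreal]
          ring
  have hmeas1 : Measurable fun t : ℝ => (C : ℝ≥0∞) * w (1 / 2 * t) :=
    ((decrRearr_measurable _).comp (measurable_const_mul (1 / 2 : ℝ))).const_mul _
  have hmeas2 : Measurable fun t : ℝ => decrRearr volume (T μ) (1 / 2 * t) :=
    (decrRearr_measurable _).comp (measurable_const_mul (1 / 2 : ℝ))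
  have hw1 : wNorm q s w ≤ K₁ * wNorm q s g := by
    have := hK₁ μ (ENNReal.ofReal R) (by simpa using hR)
    simpa only [ENNReal.rpow_one] using this
  have hw2 : wNorm q s (fun t : ℝ => (C : ℝ≥0∞) * w (1 / 2 * t)) ≤ K₂ * wNorm q s w :=
    hK₂ _ w (decrRearr_measurable _) fun t _ => by rw [ENNReal.ofReal_coe_nnreal]
  have hw3 : wNorm q s (fun t : ℝ => decrRearr volume (T μ) (1 / 2 * t)) ≤ K₃ * wNorm q s g :=
    hK₃ _ g (decrRearr_measurable _) htail
  calc wNorm q s (decrRearr volume (besselPotentialMeas β μ))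
      ≤ wNorm q s (fun t => C * w (1 / 2 * t) + decrRearr volume (T μ) (1 / 2 * t)) :=
        wNorm_mono hsplit
    _ ≤ K₄ * (wNorm q s (fun t : ℝ => (C : ℝ≥0∞) * w (1 / 2 * t)) +
        wNorm q s (fun t : ℝ => decrRearr volume (T μ) (1 / 2 * t))) := hK₄ _ _ hmeas1 hmeas2
    _ ≤ K₄ * (K₂ * (K₁ * wNorm q s g) + K₃ * wNorm q s g) := by
        gcongr
        exact hw2.trans (mul_le_mul_right hw1 _)
    _ = _ := by push_cast; ring

theorem exists_wNorm_fracMaximal_le_besselPotentialMeas {β q : ℝ} {s : ℝ≥0∞} (hβ0 : 0 < β)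
    (hβ : β < N) (R : ℝ) :
    ∃ K : ℝ≥0, ∀ (μ : Measure (EuclideanSpace ℝ (Fin N))),
      wNorm q s (decrRearr volume (fracMaximal β (ENNReal.ofReal R) μ)) ≤
        K * wNorm q s (decrRearr volume (besselPotentialMeas β μ)) := by
  obtain ⟨C, hC⟩ := exists_fracMaximal_le_besselPotentialMeas hβ0 hβ R
  refine ⟨C, fun μ => ?_⟩
  refine (wNorm_mono fun t _ => ?_).trans (wNorm_const_mul_le s C _)
  exact (decrRearr_mono (hC μ) t).trans (decrRearr_const_mul_le _ _ t)

end NormInequalities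

theorem coe_inv_mul_le_of_le_coe_mul {c c' : ℝ≥0} {a b : ℝ≥0∞} (h : a ≤ c * b) (hc : c ≤ c')
    (hc' : 0 < c') : (c' : ℝ≥0∞)⁻¹ * a ≤ b := by
  rw [ENNReal.inv_mul_le_iff (by simpa using hc'.ne') ENNReal.coe_ne_top]
  exact h.trans (by gcongr)

theorem theoremt (N : ℕ) (α p q : ℝ) (s : ℝ≥0∞)
    (hα : 0 < α) (hp : 0 < p - 1) (hpq : p - 1 < q) (hαp : α * p < (N : ℝ)) (hs : 0 < s) :
    (∃ c : ℝ≥0, 0 < c ∧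
      ∀ (R : ℝ≥0∞), 0 < R →
      ∀ (μ : Measure (EuclideanSpace ℝ (Fin N))) [IsLocallyFiniteMeasure μ],
        (c : ℝ≥0∞)⁻¹ * lorentzNorm volume q s (wolffPotential α p R μ) ≤
            lorentzNorm volume (q / (p - 1)) (s / ENNReal.ofReal (p - 1))
              (fracMaximal (α * p) R μ) ^ (1 / (p - 1)) ∧
        lorentzNorm volume (q / (p - 1)) (s / ENNReal.ofReal (p - 1))
              (fracMaximal (α * p) R μ) ^ (1 / (p - 1)) ≤
            (c : ℝ≥0∞) * lorentzNorm volume q s (wolffPotential α p R μ)) ∧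
    (∀ (R : ℝ≥0∞), 0 < R → R < ∞ → ∃ c : ℝ≥0, 0 < c ∧
      ∀ (μ : Measure (EuclideanSpace ℝ (Fin N))) [IsLocallyFiniteMeasure μ],
        ((c : ℝ≥0∞)⁻¹ * lorentzNorm volume q s (wolffPotential α p R μ) ≤
            lorentzNorm volume (q / (p - 1)) (s / ENNReal.ofReal (p - 1))
              (besselPotentialMeas (α * p) μ) ^ (1 / (p - 1)) ∧
         lorentzNorm volume (q / (p - 1)) (s / ENNReal.ofReal (p - 1))
              (besselPotentialMeas (α * p) μ) ^ (1 / (p - 1)) ≤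
            (c : ℝ≥0∞) * lorentzNorm volume q s (wolffPotential α p R μ)) ∧
        ((c : ℝ≥0∞)⁻¹ * lorentzNorm volume (q / (p - 1)) (s / ENNReal.ofReal (p - 1))
              (fracMaximal (α * p) R μ) ^ (1 / (p - 1)) ≤
            lorentzNorm volume (q / (p - 1)) (s / ENNReal.ofReal (p - 1))
              (besselPotentialMeas (α * p) μ) ^ (1 / (p - 1)) ∧
         lorentzNorm volume (q / (p - 1)) (s / ENNReal.ofReal (p - 1))
              (besselPotentialMeas (α * p) μ) ^ (1 / (p - 1)) ≤
            (c : ℝ≥0∞) * lorentzNorm volume (q / (p - 1)) (s / ENNReal.ofReal (p - 1))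
              (fracMaximal (α * p) R μ) ^ (1 / (p - 1)))) := by
  have hq : 0 < q := hp.trans hpq
  have hβ0 : 0 < α * p := mul_pos hα (by linarith)
  set θ := 1 / (p - 1) with hθ_def
  have hθ : 0 < θ := by positivity
  set q' := q / (p - 1) with hq'_def
  have hq' : q' = q * θ := by rw [hq'_def, hθ_def]; ring
  have hq'0 : 0 < q' := by positivity
  set s' := s / ENNReal.ofReal (p - 1) with hs'_def
  have hs' : s' = s * ENNReal.ofReal θ := by
    rw [hs'_def, hθ_def, one_div, ENNReal.ofReal_inv_of_pos hp, div_eq_mul_inv]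
  have hs'0 : s' ≠ 0 := by
    rw [hs']; exact mul_ne_zero hs.ne' (by simpa using hθ)
  have hpow : ∀ g : ℝ → ℝ≥0∞, wNorm q s (fun t => g t ^ θ) = wNorm q' s' g ^ θ := fun g => by
    rw [wNorm_rpow s hθ, hq', hs']
  -- Hardy's inequality on both scales.
  obtain ⟨H, hH⟩ := lorentzNorm_le_wNorm.{0} q hs.ne'
  obtain ⟨H', hH'⟩ := lorentzNorm_le_wNorm.{0} q' hs'0
  obtain ⟨K₁, hK₁⟩ := exists_wNorm_truncWolff_le (N := N) hβ0 hαp hθ hq hs.ne'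
  obtain ⟨K₂, hK₂⟩ := exists_wNorm_fracMaximal_le (N := N) (q := q) hαp.le hθ hs.ne'
  have hWM : ∀ (R : ℝ≥0∞), 0 < R → ∀ (μ : Measure (EuclideanSpace ℝ (Fin N)))
      [IsLocallyFiniteMeasure μ], lorentzNorm volume q s (wolffPotential α p R μ) ≤
        ((H * K₁ : ℝ≥0) : ℝ≥0∞) * lorentzNorm volume q' s' (fracMaximal (α * p) R μ) ^ θ := by
    intro R hR μ _
    rw [wolffPotential_eq_truncWolff, ENNReal.coe_mul, mul_assoc]
    refine (hH volume _).trans (mul_le_mul_right ((hK₁ μ R hR).trans ?_) _)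
    rw [hpow]
    exact mul_le_mul_right (ENNReal.rpow_le_rpow (wNorm_le_lorentzNorm _ _ _) hθ.le) _
  have hMW : ∀ (R : ℝ≥0∞) (μ : Measure (EuclideanSpace ℝ (Fin N))),
      lorentzNorm volume q' s' (fracMaximal (α * p) R μ) ^ θ ≤
        ((H' ^ θ * K₂ : ℝ≥0) : ℝ≥0∞) * lorentzNorm volume q s (wolffPotential α p R μ) := by
    intro R μ
    rw [wolffPotential_eq_truncWolff, ENNReal.coe_mul, mul_assoc,
      ENNReal.coe_rpow_of_nonneg _ hθ.le]
    refine (ENNReal.rpow_le_rpow (hH' volume _) hθ.le).trans ?_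
    rw [ENNReal.mul_rpow_of_nonneg _ _ hθ.le, ← hpow]
    exact mul_le_mul_right ((hK₂ μ R).trans (mul_le_mul_right (wNorm_le_lorentzNorm _ _ _) _)) _
  refine ⟨⟨H * K₁ + H' ^ θ * K₂ + 1, by positivity, fun R hR μ _ => ⟨?_, ?_⟩⟩, fun R hR hRt => ?_⟩
  · refine coe_inv_mul_le_of_le_coe_mul (hWM R hR μ) ?_ (by positivity)
    rw [add_assoc]; exact le_self_add
  · refine (hMW R μ).trans (mul_le_mul_left (ENNReal.coe_le_coe.2 ?_) _)
    exact le_add_right (le_add_left le_rfl)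
  obtain ⟨r, hr, rfl⟩ : ∃ r : ℝ, 0 < r ∧ R = ENNReal.ofReal r :=
    ⟨R.toReal, ENNReal.toReal_pos hR.ne' hRt.ne, (ENNReal.ofReal_toReal hRt.ne).symm⟩
  obtain ⟨K₃, hK₃⟩ := exists_wNorm_besselPotentialMeas_le (N := N) hβ0 hαp hq'0 hs'0 hr
  obtain ⟨K₄, hK₄⟩ := exists_wNorm_fracMaximal_le_besselPotentialMeas (N := N) (q := q')
    (s := s')
    hβ0 hαp r
  set R := ENNReal.ofReal r
  have hGM : ∀ (μ : Measure (EuclideanSpace ℝ (Fin N))) [IsLocallyFiniteMeasure μ],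
      lorentzNorm volume q' s' (besselPotentialMeas (α * p) μ) ^ θ ≤
        (((H' * K₃) ^ θ : ℝ≥0) : ℝ≥0∞) *
          lorentzNorm volume q' s' (fracMaximal (α * p) R μ) ^ θ := by
    intro μ _
    rw [ENNReal.coe_rpow_of_nonneg _ hθ.le, ← ENNReal.mul_rpow_of_nonneg _ _ hθ.le,
      ENNReal.coe_mul, mul_assoc]
    exact ENNReal.rpow_le_rpow ((hH' volume _).trans (mul_le_mul_right
      ((hK₃ μ).trans (mul_le_mul_right (wNorm_le_lorentzNorm _ _ _) _)) _)) hθ.le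
  have hMG : ∀ (μ : Measure (EuclideanSpace ℝ (Fin N))),
      lorentzNorm volume q' s' (fracMaximal (α * p) R μ) ^ θ ≤
        (((H' * K₄) ^ θ : ℝ≥0) : ℝ≥0∞) *
          lorentzNorm volume q' s' (besselPotentialMeas (α * p) μ) ^ θ := by
    intro μ
    rw [ENNReal.coe_rpow_of_nonneg _ hθ.le, ← ENNReal.mul_rpow_of_nonneg _ _ hθ.le,
      ENNReal.coe_mul, mul_assoc]
    exact ENNReal.rpow_le_rpow ((hH' volume _).trans (mul_le_mul_right
      ((hK₄ μ).trans (mul_le_mul_right (wNorm_le_lorentzNorm _ _ _) _)) _)) hθ.le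
  set c₁ := H * K₁
  set c₂ := H' ^ θ * K₂
  set c₃ := (H' * K₃) ^ θ
  set c₄ := (H' * K₄) ^ θ
  have hpos : 0 < c₁ * c₄ + c₃ * c₂ + c₃ + c₄ + 1 := by positivity
  have l1 : c₁ * c₄ ≤ c₁ * c₄ + c₃ * c₂ + c₃ + c₄ + 1 := by
    simp only [add_assoc]; exact le_self_add
  have l2 : c₃ * c₂ ≤ c₁ * c₄ + c₃ * c₂ + c₃ + c₄ + 1 := by
    simp only [add_assoc]; exact le_add_left le_self_add
  have l3 : c₃ ≤ c₁ * c₄ + c₃ * c₂ + c₃ + c₄ + 1 := by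
    simp only [add_assoc]; exact le_add_left (le_add_left le_self_add)
  have l4 : c₄ ≤ c₁ * c₄ + c₃ * c₂ + c₃ + c₄ + 1 := by
    simp only [add_assoc]; exact le_add_left (le_add_left (le_add_left le_self_add))
  refine ⟨_, hpos, fun μ _ => ⟨⟨?_, ?_⟩, ?_, ?_⟩⟩
  · refine coe_inv_mul_le_of_le_coe_mul (c := c₁ * c₄) ?_ l1 hpos
    rw [ENNReal.coe_mul, mul_assoc]
    exact (hWM R hR μ).trans (mul_le_mul_right (hMG μ) _)
  · refine le_trans ?_ (mul_le_mul_left (ENNReal.coe_le_coe.2 l2) _)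
    rw [ENNReal.coe_mul, mul_assoc]
    exact (hGM μ).trans (mul_le_mul_right (hMW R μ) _)
  · exact coe_inv_mul_le_of_le_coe_mul (hMG μ) l4 hpos
  · exact (hGM μ).trans (mul_le_mul_left (ENNReal.coe_le_coe.2 l3) _)
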